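/- Let $L$ be a finite tree with a spine, i.e. a path $(v_1,\dots,v_r)$, $r\ge 1$, in $L$ such that every vertex of $L$ is at distance at most $2$ from some $v_i$ (a tree with such a path is called a lobster, and the $v_i$ are its spinal vertices). For each $i$ the lobe $F_i$ at $v_i$ is the subtree of $L$ induced by $v_i$, the non-spinal neighbours $u$ of $v_i$, and the non-spinal neighbours of these $u$. A non-spinal neighbour of $v_i$ whose degree in $L$ is $1$ is called a pendant vertex at $v_i$, and the reduced lobe $F_i'$ is obtained from $F_i$ by deleting all pendant vertices at $v_i$. The lobster $L$ is called pairwise similar if $F_i'\cong F_{i+1}'$ (as graphs) for all odd $i\in\{1,\dots,r-1\}$, and $v_i$ is called essentially even if the degree of $v_i$ in $F_i'$ is even and non-zero. Suppose that $L$ is pairwise similar and that there is at least one pendant vertex at each essentially even spinal vertex. Then $L$ is graceful: with $m$ the number of edges of $L$, there is an injective map $f:V(L)\to\{0,1,\dots,m\}$ such that the values $|f(u)-f(v)|$, over all edges $uv$ of $L$, are pairwise distinct. -/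

import Mathlib

/-- A finite graph `G` with `m` edges is graceful if there is an injective vertex labeling with
values in `{0, 1, …, m}` for which the edge labels `|f u - f v|` are pairwise distinct. -/
def IsGraceful {V : Type*} (G : SimpleGraph V) : Prop :=
  ∃ f : V → ℕ, Function.Injective f ∧ (∀ v, f v ≤ G.edgeSet.ncard) ∧
    ∀ a b c d : V, G.Adj a b → G.Adj c d →
      |(f a : ℤ) - (f b : ℤ)| = |(f c : ℤ) - (f d : ℤ)| → s(a, b) = s(c, d)

/-- A lobster on the vertex set `V` with `r` spinal vertices: a tree with a path
`(vertex 0, …, vertex (r - 1))`, the spine, such that every vertex of the tree is at distance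
at most two from the spine. The spinal vertices are numbered from `0`. -/
structure Lobster (V : Type*) (r : ℕ) where
  graph : SimpleGraph V
  isTree : graph.IsTree
  vertex : Fin r → V
  injective : Function.Injective vertex
  adj_succ : ∀ (i : ℕ) (h : i + 1 < r),
    graph.Adj (vertex ⟨i, Nat.lt_of_succ_lt h⟩) (vertex ⟨i + 1, h⟩)
  near_spine : ∀ x : V, ∃ i : Fin r, graph.dist (vertex i) x ≤ 2

namespace Lobster

variable {V : Type*} {r : ℕ}

/-- The central vertices `u` of the branches at the spinal vertex `vertex i`. -/
def branchCenters (L : Lobster V r) (i : Fin r) : Set V :=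
  {u | L.graph.Adj (L.vertex i) u ∧ u ∉ Set.range L.vertex}

/-- The vertices of the lobe at `vertex i`: the spinal vertex itself, the centers of its
branches, and the further neighbours of these centers. -/
def lobeVerts (L : Lobster V r) (i : Fin r) : Set V :=
  {L.vertex i} ∪ L.branchCenters i ∪
    {w | w ∉ Set.range L.vertex ∧ ∃ u ∈ L.branchCenters i, L.graph.Adj u w}

/-- The lobe at a spinal vertex, as a subgraph of the lobster. -/
def lobe (L : Lobster V r) (i : Fin r) : L.graph.Subgraph :=
  (⊤ : L.graph.Subgraph).induce (L.lobeVerts i)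

/-- The pendant vertices at `vertex i`: the centers of branches having no further vertex. -/
def pendantVerts (L : Lobster V r) (i : Fin r) : Set V :=
  {u | u ∈ L.branchCenters i ∧ ∀ w, L.graph.Adj u w → w = L.vertex i}

/-- The reduced lobe: the lobe with the pendant vertices at the spinal vertex deleted. -/
def reducedLobe (L : Lobster V r) (i : Fin r) : L.graph.Subgraph :=
  (L.lobe i).deleteVerts (L.pendantVerts i)

/-- The reduced lobes at the first and second, the third and fourth, … spinal vertices are
isomorphic graphs. If `r` is odd, there is no condition on the last one. -/
def IsPairwiseSimilar (L : Lobster V r) : Prop :=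
  ∀ (k : ℕ) (h : 2 * k + 1 < r),
    Nonempty ((L.reducedLobe ⟨2 * k, Nat.lt_of_succ_lt h⟩).coe ≃g
      (L.reducedLobe ⟨2 * k + 1, h⟩).coe)

/-- The degree of `vertex i` in its reduced lobe is even and non-zero. -/
def IsEssentiallyEven (L : Lobster V r) (i : Fin r) : Prop :=
  Even ((L.reducedLobe i).neighborSet (L.vertex i)).ncard ∧
    ((L.reducedLobe i).neighborSet (L.vertex i)).ncard ≠ 0

end Lobster

/-! Root the tree at the first spinal vertex and ask for a graceful labeling with `0` at the root.
Two operations preserve such labelings: attaching a leaf to the root with a new largest label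
(`insert_leaf`), and complementing all labels so that the old root becomes largest and can hang
below a new root labeled `0` (`insert_root`). Hence pendant vertices at a root are harmless, and
each lobe may be cut down to a core that keeps the essential branches and only as many pendant
vertices as convenient. One pendant vertex is kept exactly when the number of essential branches is
even and non-zero, so a core has an odd number of branches or none.

A core with an odd number of branches is labeled directly (`exists_isRootLabeling_of_odd`). The root
gets `0`, the centers get `m, 1, m - 1, 2, …`, and the vertices at level two fill the interval in
between. Imagine all of the latter attached to the center `m`. A set of leaves invariant under `x ↦
h + l - x` can be moved from a vertex labeled `h` to one labeled `l` without changing the set of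
edge labels, since `x - l = h - (h + l - x)`. Repeating this along the zigzag leaves the prescribed
number of children at each center, provided that the centers are sorted by the parity of these
numbers, with the childless ones last.

Two consecutive lobes have isomorphic cores, and `exists_glue` joins them. One copy has its even
levels low and its odd level high, the other copy is the reverse, and everything beyond the second
spinal vertex is labeled in the gap. The edges of the two copies get labels symmetric about that of
the spinal edge joining their roots, which sits in the middle. Induction from the far end of the
spine, two lobes at a time, gives the theorem; for odd `r` it starts with a single lobe.

An isomorphism of reduced lobes need not respect the spinal vertices. It still yields a bijection of
the essential centers preserving the numbers of children (`exists_bijOn_of_iso`), which is all that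
the argument uses. -/

/-- A graceful labeling of the finite tree with vertex set `S`, root `ρ` and parent map `par`
in which the root has the label `0`. -/
structure IsRootLabeling {V : Type*} (par : V → V) (S : Finset V) (ρ : V) (f : V → ℤ) : Prop where
  root_mem : ρ ∈ S
  root : f ρ = 0
  par_mem : ∀ x ∈ S, x ≠ ρ → par x ∈ S
  nonneg : ∀ x ∈ S, 0 ≤ f x
  lt : ∀ x ∈ S, f x < S.card
  inj : ∀ x ∈ S, ∀ y ∈ S, f x = f y → x = y
  diff : ∀ x ∈ S, x ≠ ρ → ∀ y ∈ S, y ≠ ρ → |f x - f (par x)| = |f y - f (par y)| → x = y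

/-! ### Operations on labelings with root label zero -/

namespace IsRootLabeling

variable {V : Type*} {par : V → V} {S : Finset V} {ρ : V} {f : V → ℤ}

theorem singleton (par : V → V) (ρ : V) : IsRootLabeling par {ρ} ρ (fun _ => 0) where
  root_mem := by simp
  root := rfl
  par_mem := by simp
  nonneg := by simp
  lt := by simp
  inj := by simp
  diff := by simp

theorem abs_diff_lt (hf : IsRootLabeling par S ρ f) {x : V} (hx : x ∈ S) (hxρ : x ≠ ρ) :
    |f x - f (par x)| < S.card := by
  have h1 := hf.par_mem x hx hxρ
  have := hf.nonneg x hx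
  have := hf.lt x hx
  have := hf.nonneg _ h1
  have := hf.lt _ h1
  rw [abs_lt]; constructor <;> omega

/-- The old vertex and edge labels are all below `S.card`, so this value is free both for the leaf
and for its edge to the root. -/
theorem insert_leaf [DecidableEq V] (hf : IsRootLabeling par S ρ f) {a : V} (ha : a ∉ S)
    (hpar : par a = ρ) :
    IsRootLabeling par (insert a S) ρ (fun x => if x = a then (S.card : ℤ) else f x) := by
  have hne : ∀ x ∈ S, x ≠ a := fun x hx h => ha (h ▸ hx)
  have hρ : ρ ≠ a := hne _ hf.root_mem
  have hda : |(S.card : ℤ) - f ρ| = S.card := by rw [hf.root]; simp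
  refine ⟨by simp [hf.root_mem], by simp [hρ, hf.root], ?_, ?_, ?_, ?_, ?_⟩
  · intro x hx hxρ
    rcases Finset.mem_insert.1 hx with rfl | hx
    · simp [hpar, hf.root_mem]
    · exact Finset.mem_insert_of_mem (hf.par_mem x hx hxρ)
  · intro x hx
    rcases Finset.mem_insert.1 hx with rfl | hx
    · simp
    · simpa [hne x hx] using hf.nonneg x hx
  · intro x hx
    rw [Finset.card_insert_of_notMem ha]
    rcases Finset.mem_insert.1 hx with rfl | hx
    · simp
    · have := hf.lt x hx
      simp only [hne x hx, if_false]; push_cast; omega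
  · intro x hx y hy hxy
    rw [Finset.mem_insert] at hx hy
    rcases hx with rfl | hx <;> rcases hy with rfl | hy
    · rfl
    · have := hf.lt y hy
      simp only [hne y hy, if_false, if_true] at hxy; omega
    · have := hf.lt x hx
      simp only [hne x hx, if_false, if_true] at hxy; omega
    · simp only [hne x hx, hne y hy, if_false] at hxy
      exact hf.inj x hx y hy hxy
  · intro x hx hxρ y hy hyρ hxy
    rw [Finset.mem_insert] at hx hy
    rcases hx with rfl | hx <;> rcases hy with rfl | hy
    · rfl
    · have := hf.abs_diff_lt hy hyρ
      simp only [hne y hy, hpar, hρ, hne _ (hf.par_mem y hy hyρ), if_false, if_true] at hxy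
      omega
    · have := hf.abs_diff_lt hx hxρ
      simp only [hne x hx, hpar, hρ, hne _ (hf.par_mem x hx hxρ), if_false, if_true] at hxy
      omega
    · simp only [hne x hx, hne y hy, hne _ (hf.par_mem x hx hxρ), hne _ (hf.par_mem y hy hyρ),
        if_false] at hxy
      exact hf.diff x hx hxρ y hy hyρ hxy

theorem exists_union_leaves [DecidableEq V] (hf : ∃ f, IsRootLabeling par S ρ f) (P : Finset V)
    (hpar : ∀ a ∈ P, par a = ρ) : ∃ f, IsRootLabeling par (P ∪ S) ρ f := by
  induction P using Finset.induction_on with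
  | empty => simpa using hf
  | insert a P _ ih =>
    obtain ⟨g, hg⟩ := ih fun b hb => hpar b (Finset.mem_insert_of_mem hb)
    rw [Finset.insert_union]
    by_cases h : a ∈ P ∪ S
    · rw [Finset.insert_eq_of_mem h]; exact ⟨g, hg⟩
    · exact ⟨_, hg.insert_leaf h (hpar a (Finset.mem_insert_self _ _))⟩

/-- Complementing keeps the old edge labels and frees `0` for the new root; the edge to the old
root, now labeled `S.card`, exceeds all the others. -/
theorem insert_root [DecidableEq V] (hf : IsRootLabeling par S ρ f) {τ : V} (hτ : τ ∉ S)
    (hpar : par ρ = τ) :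
    IsRootLabeling par (insert τ S) τ (fun x => if x = τ then 0 else (S.card : ℤ) - f x) := by
  have hne : ∀ x ∈ S, x ≠ τ := fun x hx h => hτ (h ▸ hx)
  have hρ : ρ ≠ τ := hne _ hf.root_mem
  have key : ∀ x ∈ S, x ≠ ρ → |((S.card : ℤ) - f x) - (S.card - f (par x))| =
      |f x - f (par x)| := fun x _ _ => by
    rw [← abs_neg]; congr 1; ring
  refine ⟨by simp, by simp, ?_, ?_, ?_, ?_, ?_⟩
  · intro x hx hxτ
    rcases Finset.mem_insert.1 hx with rfl | hx
    · exact absurd rfl hxτ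
    · by_cases h : x = ρ
      · subst h; simp [hpar]
      · exact Finset.mem_insert_of_mem (hf.par_mem x hx h)
  · intro x hx
    rcases Finset.mem_insert.1 hx with rfl | hx
    · simp
    · have := hf.lt x hx
      simp only [hne x hx, if_false]; omega
  · intro x hx
    rw [Finset.card_insert_of_notMem hτ]
    rcases Finset.mem_insert.1 hx with rfl | hx
    · simp
    · have := hf.nonneg x hx
      simp only [hne x hx, if_false]; push_cast; omega
  · intro x hx y hy hxy
    rw [Finset.mem_insert] at hx hy
    rcases hx with rfl | hx <;> rcases hy with rfl | hy
    · rfl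
    · have := hf.lt y hy
      simp only [hne y hy, if_false, if_true] at hxy; omega
    · have := hf.lt x hx
      simp only [hne x hx, if_false, if_true] at hxy; omega
    · simp only [hne x hx, hne y hy, if_false] at hxy
      exact hf.inj x hx y hy (by omega)
  · intro x hx hxτ y hy hyτ hxy
    replace hx := Finset.mem_of_mem_insert_of_ne hx hxτ
    replace hy := Finset.mem_of_mem_insert_of_ne hy hyτ
    by_cases h : x = ρ <;> by_cases h' : y = ρ
    · rw [h, h']
    · have := hf.abs_diff_lt hy h'
      subst h
      simp only [hxτ, hyτ, hpar, hne _ (hf.par_mem y hy h'), if_false, if_true, key y hy h',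
        hf.root, sub_zero, Nat.abs_cast] at hxy
      omega
    · have := hf.abs_diff_lt hx h
      subst h'
      simp only [hxτ, hyτ, hpar, hne _ (hf.par_mem x hx h), if_false, if_true, key x hx h,
        hf.root, sub_zero, Nat.abs_cast] at hxy
      omega
    · simp only [hxτ, hyτ, hne _ (hf.par_mem y hy h'), hne _ (hf.par_mem x hx h), if_false,
        key x hx h, key y hy h'] at hxy
      exact hf.diff x hx h y hy h' hxy

/-- Two copies of a tree `T`, with adjacent roots, and a tree hanging from the root of the second
copy: the levels of one parity of `T` are placed below, the other ones above the hanging tree, and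
in the second copy the other way round. -/
theorem exists_glue [DecidableEq V] {T I : Finset V} {σ : V} {h : V → ℤ} {φ : V → V}
    {upper : V → Prop} (hf : IsRootLabeling par T ρ f) (hh : IsRootLabeling par I σ h)
    (hφ : Set.InjOn φ T) (hφρ : φ ρ = σ) (hφpar : ∀ x ∈ T, x ≠ ρ → par (φ x) = φ (par x))
    (hupper : ∀ x ∈ T, x ≠ ρ → (upper (par x) ↔ ¬ upper x)) (hρ : ¬ upper ρ)
    (hσ : par σ = ρ) (hTI : Disjoint T I) (hTφ : ∀ x ∈ T, ∀ y ∈ T, x ≠ φ y)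
    (hIφ : ∀ x ∈ I, ∀ y ∈ T, x = φ y → y = ρ) :
    ∃ F, IsRootLabeling par (T ∪ (T.image φ ∪ I)) ρ F := by
  classical
  -- The root `σ` of `I` is also the root of the copy of `T`, so `I` contributes only `K` further
  -- vertices.
  obtain ⟨K, hK⟩ : ∃ K, I.card = K + 1 :=
    ⟨I.card - 1, by have := Finset.card_pos.2 ⟨σ, hh.root_mem⟩; omega⟩
  set n := T.card with hn
  have hcard : (T ∪ (T.image φ ∪ I)).card = 2 * n + K := by
    have h1 : T.image φ ∩ I = {σ} := by
      ext z
      simp only [Finset.mem_inter, Finset.mem_image, Finset.mem_singleton]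
      constructor
      · rintro ⟨⟨y, hy, rfl⟩, hz⟩
        rw [hIφ _ hz y hy rfl, hφρ]
      · rintro rfl
        exact ⟨⟨ρ, hf.root_mem, hφρ⟩, hh.root_mem⟩
    have h2 := Finset.card_union_add_card_inter (T.image φ) I
    rw [h1, Finset.card_singleton, Finset.card_image_of_injOn hφ] at h2
    have h3 : Disjoint T (T.image φ ∪ I) := by
      rw [Finset.disjoint_union_right]
      refine ⟨?_, hTI⟩
      rw [Finset.disjoint_left]
      intro x hx hx'
      obtain ⟨y, hy, rfl⟩ := Finset.mem_image.1 hx'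
      exact hTφ _ hx y hy rfl
    rw [Finset.card_union_of_disjoint h3]
    omega
  have hTI' : ∀ x ∈ I, x ∉ T := fun x hx hx' => Finset.disjoint_left.1 hTI hx' hx
  -- Each value of `f` is used once low and once high, so `T` and its copy occupy parts of `[0, n)`
  -- and `[n + K, 2n + K)` without collision. The tree `I` uses `[n, n + K]`, meeting the upper
  -- block only in the label of `σ`.
  let F : V → ℤ := fun x =>
    if x ∈ T then (if upper x then f x + K + n else f x)
    else if hx : ∃ y ∈ T, φ y = x then
      (if upper hx.choose then f hx.choose else f hx.choose + K + n)
    else n + K - h x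
  have F1 : ∀ x ∈ T, F x = if upper x then f x + K + n else f x := fun x hx => by
    simp only [F, hx, if_true]
  have F2 : ∀ x ∈ T, F (φ x) = if upper x then f x else f x + K + n := fun x hx => by
    have h0 : φ x ∉ T := fun h0 => hTφ _ h0 x hx rfl
    have h1 : ∃ y ∈ T, φ y = φ x := ⟨x, hx, rfl⟩
    have h2 : h1.choose = x := hφ h1.choose_spec.1 hx h1.choose_spec.2
    simp only [F, h0, if_false, h1, dif_pos, h2]
  have F3 : ∀ x ∈ I, F x = n + K - h x := fun x hx => by
    -- At the shared vertex `σ` both rules give `n + K`.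
    by_cases h1 : x = σ
    · rw [h1, ← hφρ, F2 ρ hf.root_mem, hφρ, hh.root, hf.root]
      simp only [hρ, if_false]; ring
    · have h2 : ¬ ∃ y ∈ T, φ y = x := by
        rintro ⟨y, hy, rfl⟩
        exact h1 (by rw [hIφ _ hx y hy rfl, hφρ])
      simp only [F, hTI' x hx, if_false, h2, dif_neg, not_false_iff]
  have cases : ∀ x ∈ T ∪ (T.image φ ∪ I), x ∈ T ∨ (∃ y ∈ T, y ≠ ρ ∧ x = φ y) ∨ x ∈ I := by
    intro x hx
    simp only [Finset.mem_union, Finset.mem_image] at hx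
    rcases hx with hx | ⟨y, hy, rfl⟩ | hx
    · exact Or.inl hx
    · by_cases h1 : y = ρ
      · exact Or.inr (Or.inr (by rw [h1, hφρ]; exact hh.root_mem))
      · exact Or.inr (Or.inl ⟨y, hy, h1, rfl⟩)
    · exact Or.inr (Or.inr hx)
  have bT : ∀ x ∈ T, 0 ≤ f x ∧ f x < n := fun x hx => ⟨hf.nonneg x hx, hf.lt x hx⟩
  have posT : ∀ x ∈ T, x ≠ ρ → 0 < f x := fun x hx hxρ => by
    rcases (bT x hx).1.lt_or_eq with h1 | h1
    · exact h1
    · exact absurd (hf.inj x hx ρ hf.root_mem (by rw [hf.root, h1])) hxρ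
  have bI : ∀ x ∈ I, 0 ≤ h x ∧ h x < K + 1 := fun x hx =>
    ⟨hh.nonneg x hx, by have := hh.lt x hx; rw [hK] at this; exact_mod_cast this⟩
  -- The signed edge label, upper end minus lower end. Separating the levels by `K + n` turns it
  -- into `K + n + δ` in `T` and `K + n - δ` in the copy, both larger than every edge label of `I`.
  let δ : V → ℤ := fun x => if upper x then f x - f (par x) else f (par x) - f x
  have absδ : ∀ x, |δ x| = |f x - f (par x)| := fun x => by
    by_cases h1 : upper x
    · simp only [δ, h1, if_true]
    · simp only [δ, h1, if_false]; exact abs_sub_comm _ _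
  have bδ : ∀ x ∈ T, x ≠ ρ → -(n : ℤ) < δ x ∧ δ x < n := fun x hx hxρ => by
    have := hf.abs_diff_lt hx hxρ
    rw [← absδ, abs_lt] at this
    exact this
  have δ0 : ∀ x ∈ T, x ≠ ρ → δ x ≠ 0 := fun x hx hxρ h0 => by
    have h1 : |f x - f (par x)| = 0 := by rw [← absδ, h0, abs_zero]
    have h2 : x = par x := hf.inj x hx _ (hf.par_mem x hx hxρ)
      (by have := abs_eq_zero.1 h1; omega)
    have := hupper x hx hxρ
    rw [← h2] at this
    tauto
  have D1 : ∀ x ∈ T, x ≠ ρ → |F x - F (par x)| = K + n + δ x := fun x hx hxρ => by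
    have := bδ x hx hxρ
    rw [F1 x hx, F1 _ (hf.par_mem x hx hxρ)]
    by_cases h1 : upper x
    · have h2 : ¬ upper (par x) := fun h2 => (hupper x hx hxρ).1 h2 h1
      simp only [δ, h1, if_true, h2, if_false] at this ⊢
      rw [abs_of_nonneg] <;> omega
    · have h2 : upper (par x) := (hupper x hx hxρ).2 h1
      simp only [δ, h1, if_true, h2, if_false] at this ⊢
      rw [abs_of_nonpos] <;> omega
  have D2 : ∀ x ∈ T, x ≠ ρ → |F (φ x) - F (par (φ x))| = K + n - δ x := fun x hx hxρ => by
    have := bδ x hx hxρ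
    rw [hφpar x hx hxρ, F2 x hx, F2 _ (hf.par_mem x hx hxρ)]
    by_cases h1 : upper x
    · have h2 : ¬ upper (par x) := fun h2 => (hupper x hx hxρ).1 h2 h1
      simp only [δ, h1, if_true, h2, if_false] at this ⊢
      rw [abs_of_nonpos] <;> omega
    · have h2 : upper (par x) := (hupper x hx hxρ).2 h1
      simp only [δ, h1, if_true, h2, if_false] at this ⊢
      rw [abs_of_nonneg] <;> omega
  have Dσ : |F σ - F (par σ)| = K + n := by
    rw [F3 σ hh.root_mem, hσ, F1 ρ hf.root_mem, hh.root, hf.root]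
    simp only [hρ, if_false]
    rw [abs_of_nonneg] <;> omega
  have D3 : ∀ x ∈ I, x ≠ σ → |F x - F (par x)| = |h x - h (par x)| := fun x hx hxσ => by
    rw [F3 x hx, F3 _ (hh.par_mem x hx hxσ), abs_sub_comm]
    congr 1; ring
  have D3' : ∀ x ∈ I, x ≠ σ → |F x - F (par x)| < K + 1 := fun x hx hxσ => by
    rw [D3 x hx hxσ]
    have := hh.abs_diff_lt hx hxσ
    rw [hK] at this; exact_mod_cast this
  have casesD : ∀ x ∈ T ∪ (T.image φ ∪ I), x ≠ ρ →
      (x ∈ T) ∨ (∃ y ∈ T, y ≠ ρ ∧ x = φ y) ∨ x = σ ∨ (x ∈ I ∧ x ≠ σ) := by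
    intro x hx _
    rcases cases x hx with h1 | h1 | h1
    · exact Or.inl h1
    · exact Or.inr (Or.inl h1)
    · by_cases h2 : x = σ
      · exact Or.inr (Or.inr (Or.inl h2))
      · exact Or.inr (Or.inr (Or.inr ⟨h1, h2⟩))
  have eqδ : ∀ x ∈ T, x ≠ ρ → ∀ y ∈ T, y ≠ ρ → (δ x = δ y ∨ δ x = - δ y) → x = y := by
    intro x hx hxρ y hy hyρ h1
    refine hf.diff x hx hxρ y hy hyρ ?_
    rw [← absδ, ← absδ]
    exact abs_eq_abs.2 h1
  have eqδ' : ∀ x ∈ T, x ≠ ρ → ∀ y ∈ T, y ≠ ρ → δ x ≠ - δ y := by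
    intro x hx hxρ y hy hyρ h1
    have h2 := eqδ x hx hxρ y hy hyρ (Or.inr h1)
    subst h2
    have := δ0 x hx hxρ
    omega
  have hn0 : 0 < n := Finset.card_pos.2 ⟨ρ, hf.root_mem⟩
  refine ⟨F, ?_, ?_, ?_, ?_, ?_, ?_, ?_⟩
  · exact Finset.mem_union_left _ hf.root_mem
  · rw [F1 ρ hf.root_mem, hf.root]; simp [hρ]
  · intro x hx hxρ
    simp only [Finset.mem_union, Finset.mem_image]
    rcases casesD x hx hxρ with h1 | ⟨y, hy, hyρ, rfl⟩ | rfl | ⟨h1, h2⟩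
    · exact Or.inl (hf.par_mem x h1 hxρ)
    · exact Or.inr (Or.inl ⟨par y, hf.par_mem y hy hyρ, (hφpar y hy hyρ).symm⟩)
    · rw [hσ]; exact Or.inl hf.root_mem
    · exact Or.inr (Or.inr (hh.par_mem x h1 h2))
  · intro x hx
    rcases cases x hx with h1 | ⟨y, hy, hyρ, rfl⟩ | h1
    · rw [F1 x h1]; have := bT x h1; split_ifs <;> omega
    · rw [F2 y hy]; have := bT y hy; split_ifs <;> omega
    · rw [F3 x h1]; have := bI x h1; omega
  · intro x hx
    rw [hcard]; push_cast
    rcases cases x hx with h1 | ⟨y, hy, hyρ, rfl⟩ | h1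
    · rw [F1 x h1]; have := bT x h1; split_ifs <;> omega
    · rw [F2 y hy]; have := bT y hy; split_ifs <;> omega
    · rw [F3 x h1]; have := bI x h1; omega
  · intro x hx y hy hxy
    rcases cases x hx with h1 | ⟨x, h1, hxρ, rfl⟩ | h1 <;>
      rcases cases y hy with h2 | ⟨y, h2, hyρ, rfl⟩ | h2
    · rw [F1 x h1, F1 y h2] at hxy
      have := bT x h1
      have := bT y h2
      refine hf.inj x h1 y h2 ?_
      split_ifs at hxy <;> omega
    · rw [F1 x h1, F2 y h2] at hxy
      have := bT x h1
      have := bT y h2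
      have h3 : f x = f y → x = y := hf.inj x h1 y h2
      split_ifs at hxy with u1 u2 u2
      · omega
      · exact absurd (h3 (by omega)) (fun h4 => u2 (h4 ▸ u1))
      · exact absurd (h3 (by omega)) (fun h4 => u1 (h4 ▸ u2))
      · omega
    · rw [F1 x h1, F3 y h2] at hxy
      have := bT x h1
      have := bI y h2
      by_cases h3 : x = ρ
      · subst h3; simp only [hρ, if_false] at hxy; omega
      · have := posT x h1 h3
        split_ifs at hxy <;> omega
    · rw [F2 x h1, F1 y h2] at hxy
      have := bT x h1
      have := bT y h2
      have h3 : f x = f y → x = y := hf.inj x h1 y h2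
      split_ifs at hxy with u1 u2 u2
      · omega
      · exact absurd (h3 (by omega)) (fun h4 => u2 (h4 ▸ u1))
      · exact absurd (h3 (by omega)) (fun h4 => u1 (h4 ▸ u2))
      · omega
    · rw [F2 x h1, F2 y h2] at hxy
      have := bT x h1
      have := bT y h2
      congr 1
      refine hf.inj x h1 y h2 ?_
      split_ifs at hxy <;> omega
    · rw [F2 x h1, F3 y h2] at hxy
      have := bT x h1
      have := bI y h2
      have := posT x h1 hxρ
      split_ifs at hxy <;> omega
    · rw [F3 x h1, F1 y h2] at hxy
      have := bT y h2
      have := bI x h1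
      by_cases h3 : y = ρ
      · subst h3; simp only [hρ, if_false] at hxy; omega
      · have := posT y h2 h3
        split_ifs at hxy <;> omega
    · rw [F3 x h1, F2 y h2] at hxy
      have := bT y h2
      have := bI x h1
      have := posT y h2 hyρ
      split_ifs at hxy <;> omega
    · rw [F3 x h1, F3 y h2] at hxy
      exact hh.inj x h1 y h2 (by omega)
  · intro x hx hxρ y hy hyρ hxy
    rcases casesD x hx hxρ with h1 | ⟨x, h1, hxρ', rfl⟩ | rfl | ⟨h1, h1'⟩ <;>
      rcases casesD y hy hyρ with h2 | ⟨y, h2, hyρ', rfl⟩ | rfl | ⟨h2, h2'⟩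
    · rw [D1 x h1 hxρ, D1 y h2 hyρ] at hxy
      exact eqδ x h1 hxρ y h2 hyρ (Or.inl (by omega))
    · rw [D1 x h1 hxρ, D2 y h2 hyρ'] at hxy
      exact absurd (by omega) (eqδ' x h1 hxρ y h2 hyρ')
    · rw [D1 x h1 hxρ, Dσ] at hxy
      exact absurd (by omega) (δ0 x h1 hxρ)
    · have := D3' y h2 h2'
      have := bδ x h1 hxρ
      rw [D1 x h1 hxρ] at hxy; omega
    · rw [D2 x h1 hxρ', D1 y h2 hyρ] at hxy
      exact absurd (by omega) (eqδ' x h1 hxρ' y h2 hyρ)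
    · rw [D2 x h1 hxρ', D2 y h2 hyρ'] at hxy
      rw [eqδ x h1 hxρ' y h2 hyρ' (Or.inl (by omega))]
    · rw [D2 x h1 hxρ', Dσ] at hxy
      exact absurd (by omega) (δ0 x h1 hxρ')
    · have := D3' y h2 h2'
      have := bδ x h1 hxρ'
      rw [D2 x h1 hxρ'] at hxy; omega
    · rw [D1 y h2 hyρ, Dσ] at hxy
      exact absurd (by omega) (δ0 y h2 hyρ)
    · rw [D2 y h2 hyρ', Dσ] at hxy
      exact absurd (by omega) (δ0 y h2 hyρ')
    · rfl
    · have := D3' y h2 h2'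
      rw [Dσ] at hxy; omega
    · have := D3' x h1 h1'
      have := bδ y h2 hyρ
      rw [D1 y h2 hyρ] at hxy; omega
    · have := D3' x h1 h1'
      have := bδ y h2 hyρ'
      rw [D2 y h2 hyρ'] at hxy; omega
    · have := D3' x h1 h1'
      rw [Dσ] at hxy; omega
    · rw [D3 x h1 h1', D3 y h2 h2'] at hxy
      exact hh.diff x h1 h1' y h2 h2' hxy

end IsRootLabeling

/-! ### Distributing the vertices at level two by transfers -/

/-- The labels `h, l, h - 1, l + 1, …`. -/
def zigzag (h l : ℤ) (j : ℕ) : ℤ := if j % 2 = 0 then h - (j / 2 : ℕ) else l + (j / 2 : ℕ)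

theorem zigzag_zero (h l : ℤ) : zigzag h l 0 = h := by simp [zigzag]

/-- Negation turns the zigzag without its first term into a zigzag again, so the recursion over the
centers always hands out from the high end. -/
theorem zigzag_reflect (h l : ℤ) (j : ℕ) : zigzag (-l) (1 - h) j = - zigzag h l (j + 1) := by
  unfold zigzag
  split_ifs <;> omega

theorem zigzag_tail {V : Type*} {w : V} {ws : List V} {lab : V → ℤ} {h l : ℤ}
    (hlab : ∀ (j : ℕ) (hj : j < (w :: ws).length), lab (w :: ws)[j] = zigzag h l j) (j : ℕ)
    (hj : j < ws.length) : - lab ws[j] = zigzag (-l) (1 - h) j := by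
  rw [zigzag_reflect, ← hlab (j + 1) (by simpa using hj)]
  simp

/-- The map `g` labels those `x ∈ C` whose parent belongs to `ws` by elements of `X`, where the
parents are labeled by `lab`, with distinct vertex labels and distinct edge labels, and the edge
labels are among those of the star with center `h` and leaves in `X`. -/
structure IsDistribution {V : Type*} (par : V → V) (C : Finset V) (ws : List V) (lab : V → ℤ)
    (h : ℤ) (X : Set ℤ) (g : V → ℤ) : Prop where
  mem : ∀ x ∈ C, par x ∈ ws → g x ∈ X
  diff_mem : ∀ x ∈ C, par x ∈ ws → h - |g x - lab (par x)| ∈ X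
  inj : ∀ x ∈ C, par x ∈ ws → ∀ y ∈ C, par y ∈ ws → g x = g y → x = y
  diff : ∀ x ∈ C, par x ∈ ws → ∀ y ∈ C, par y ∈ ws →
    |g x - lab (par x)| = |g y - lab (par y)| → x = y

namespace IsDistribution

variable {V : Type*} [DecidableEq V] {par : V → V} {C : Finset V} {ws : List V} {lab : V → ℤ}
  {h l : ℤ} {X : Set ℤ} {g : V → ℤ}

theorem of_card_eq_zero (hc : (C.filter fun x => par x ∈ ws).card = 0) :
    IsDistribution par C ws lab h X g := by
  have h0 : ∀ x ∈ C, par x ∉ ws := by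
    intro x hx hx'
    rw [Finset.card_eq_zero] at hc
    have : x ∈ C.filter fun x => par x ∈ ws := Finset.mem_filter.2 ⟨hx, hx'⟩
    rw [hc] at this
    simp at this
  exact ⟨fun x hx hx' => absurd hx' (h0 x hx), fun x hx hx' => absurd hx' (h0 x hx),
    fun x hx hx' => absurd hx' (h0 x hx), fun x hx hx' => absurd hx' (h0 x hx)⟩

/-- One transfer: the children of `w` take the labels in `R`, and the labels in `X` pass to the
remaining centers, of which the first is labeled `l`. Undoing the reflection in `hg` gives edge
labels `d` with `l + d ∈ X`, and the symmetry `hX` turns this into `h - d ∈ X`. -/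
theorem exists_cons {w : V} {R : Finset ℤ} (hw : w ∉ ws)
    (hR : (C.filter fun x => par x = w).card = R.card) (hRX : ∀ r ∈ R, r ∉ X)
    (hRh : ∀ r ∈ R, r ≤ h) (hlab : lab w = h) (hX : ∀ x ∈ X, h + l - x ∈ X)
    (hg : IsDistribution par C ws (fun v => - lab v) (-l) {x | -x ∈ X} g) :
    ∃ g, IsDistribution par C (w :: ws) lab h (↑R ∪ X) g := by
  let e := Finset.equivOfCardEq hR
  let G : V → ℤ := fun x => if hx : x ∈ C.filter fun x => par x = w then e ⟨x, hx⟩ else - g x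
  have G1 : ∀ x ∈ C, par x = w → G x ∈ R := fun x hx hxw => by
    have h1 : x ∈ C.filter fun x => par x = w := Finset.mem_filter.2 ⟨hx, hxw⟩
    simp only [G, h1, dif_pos]
    exact (e ⟨x, h1⟩).2
  have G1' : ∀ x ∈ C, par x = w → ∀ y ∈ C, par y = w → G x = G y → x = y := by
    intro x hx hxw y hy hyw hxy
    have h1 : x ∈ C.filter fun x => par x = w := Finset.mem_filter.2 ⟨hx, hxw⟩
    have h2 : y ∈ C.filter fun x => par x = w := Finset.mem_filter.2 ⟨hy, hyw⟩
    simp only [G, h1, h2, dif_pos] at hxy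
    simpa using e.injective (Subtype.ext hxy)
  have G2 : ∀ x ∈ C, par x ∈ ws → G x = - g x := fun x _ hxw => by
    have h1 : x ∉ C.filter fun x => par x = w := fun h1 =>
      hw ((Finset.mem_filter.1 h1).2 ▸ hxw)
    simp only [G, h1, dif_neg, not_false_iff]
  have D1 : ∀ x ∈ C, par x = w → |G x - lab (par x)| = h - G x := fun x hx hxw => by
    have := hRh _ (G1 x hx hxw)
    rw [hxw, hlab, abs_of_nonpos] <;> omega
  have D2 : ∀ x ∈ C, par x ∈ ws → |G x - lab (par x)| = |g x - - lab (par x)| :=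
    fun x hx hxw => by
      rw [G2 x hx hxw, ← abs_neg]; congr 1; ring
  have X1 : ∀ x ∈ C, par x ∈ ws → G x ∈ X := fun x hx hxw => by
    rw [G2 x hx hxw]; exact hg.mem x hx hxw
  have X2 : ∀ x ∈ C, par x ∈ ws → h - |G x - lab (par x)| ∈ X := fun x hx hxw => by
    have h1 := hX _ (hg.diff_mem x hx hxw)
    rw [D2 x hx hxw]
    convert h1 using 1
    ring
  refine ⟨G, ?_, ?_, ?_, ?_⟩
  · intro x hx hxw
    rcases List.mem_cons.1 hxw with h1 | h1
    · exact Or.inl (G1 x hx h1)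
    · exact Or.inr (X1 x hx h1)
  · intro x hx hxw
    rcases List.mem_cons.1 hxw with h1 | h1
    · refine Or.inl ?_
      rw [D1 x hx h1, sub_sub_cancel]
      exact G1 x hx h1
    · exact Or.inr (X2 x hx h1)
  · intro x hx hxw y hy hyw hxy
    rcases List.mem_cons.1 hxw with h1 | h1 <;> rcases List.mem_cons.1 hyw with h2 | h2
    · exact G1' x hx h1 y hy h2 hxy
    · exact absurd (X1 y hy h2) (hRX _ (hxy ▸ G1 x hx h1))
    · exact absurd (X1 x hx h1) (hRX _ (hxy ▸ G1 y hy h2))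
    · rw [G2 x hx h1, G2 y hy h2] at hxy
      exact hg.inj x hx h1 y hy h2 (by omega)
  · intro x hx hxw y hy hyw hxy
    rcases List.mem_cons.1 hxw with h1 | h1 <;> rcases List.mem_cons.1 hyw with h2 | h2
    · rw [D1 x hx h1, D1 y hy h2] at hxy
      exact G1' x hx h1 y hy h2 (by omega)
    · have h3 := X2 y hy h2
      rw [← hxy, D1 x hx h1, sub_sub_cancel] at h3
      exact absurd h3 (hRX _ (G1 x hx h1))
    · have h3 := X2 x hx h1
      rw [hxy, D1 y hy h2, sub_sub_cancel] at h3
      exact absurd h3 (hRX _ (G1 y hy h2))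
    · rw [D2 x hx h1, D2 y hy h2] at hxy
      exact hg.diff x hx h1 y hy h2 hxy

end IsDistribution

section Distribution

variable {V : Type*} [DecidableEq V] (par : V → V) (C : Finset V)

/-- The number of children of `w` in `C`. -/
def childCount (w : V) : ℕ := (C.filter fun x => par x = w).card

variable {par C}

theorem card_filter_mem_cons {w : V} {ws : List V} (hw : w ∉ ws) :
    (C.filter fun x => par x ∈ w :: ws).card =
      childCount par C w + (C.filter fun x => par x ∈ ws).card := by
  rw [childCount, ← Finset.card_union_of_disjoint]
  · congr 1
    ext x
    simp only [List.mem_cons, Finset.mem_filter, Finset.mem_union]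
    tauto
  · rw [Finset.disjoint_filter]
    intro x _ h1 h2
    exact hw (h1 ▸ h2)

theorem card_filter_mem_eq_zero {ws : List V} (h : ∀ w ∈ ws, childCount par C w = 0) :
    (C.filter fun x => par x ∈ ws).card = 0 := by
  rw [Finset.card_eq_zero, Finset.filter_eq_empty_iff]
  intro x hx hxw
  have h1 := h _ hxw
  rw [childCount, Finset.card_eq_zero, Finset.filter_eq_empty_iff] at h1
  exact h1 hx rfl

theorem even_card_filter_mem {ws : List V} (hws : ws.Nodup)
    (h : ∀ w ∈ ws, Even (childCount par C w)) :
    Even (C.filter fun x => par x ∈ ws).card := by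
  induction ws with
  | nil => simp
  | cons w ws ih =>
    rw [List.nodup_cons] at hws
    rw [card_filter_mem_cons hws.1]
    exact (h w (by simp)).add (ih hws.2 fun v hv => h v (by simp [hv]))

/-- An even number of children cannot be removed from an interval so as to leave an interval
centered for the next transfer. Two blocks of equal size have the needed freedom, as one of the
labels removed comes from the inner end of the upper block. Each such step removes at least two
labels, so centers without children must come last. -/
theorem exists_distribution_of_even (ws : List V) : ∀ (lab : V → ℤ) (h l p q : ℤ) (t : ℕ),
    ws.Nodup → (∀ w ∈ ws, Even (childCount par C w)) →
    ws.Pairwise (fun v w => childCount par C v = 0 → childCount par C w = 0) →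
    (C.filter fun x => par x ∈ ws).card = 2 * t →
    (∀ (j : ℕ) (hj : j < ws.length), lab ws[j] = zigzag h l j) →
    p + q = h + l - 1 → l ≤ p → q < h → p + 2 * t ≤ q + 1 →
    ∃ g, IsDistribution par C ws lab h {x | p ≤ x ∧ x < p + t ∨ q - t < x ∧ x ≤ q} g := by
  induction ws with
  | nil =>
    intro lab h l p q t _ _ _ _ _ _ _ _ _
    exact ⟨0, IsDistribution.of_card_eq_zero (by simp)⟩
  | cons w ws ih =>
    intro lab h l p q t hnd heven hpw hcard hlab hpq hlp hqh ht
    by_cases h0 : childCount par C w = 0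
    · refine ⟨0, IsDistribution.of_card_eq_zero (card_filter_mem_eq_zero ?_)⟩
      intro v hv
      rcases List.mem_cons.1 hv with rfl | hv
      · exact h0
      · exact (List.pairwise_cons.1 hpw).1 v hv h0
    · rw [List.nodup_cons] at hnd
      obtain ⟨k, hk⟩ : ∃ k, childCount par C w = 2 * k + 2 := by
        obtain ⟨k, hk⟩ := heven w (by simp)
        exact ⟨k - 1, by omega⟩
      rw [card_filter_mem_cons hnd.1, hk] at hcard
      obtain ⟨g, hg⟩ := ih (fun v => - lab v) (-l) (1 - h) (-(q - k)) (-(p + k + 1)) (t - k - 1)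
        hnd.2 (fun v hv => heven v (by simp [hv])) (List.pairwise_cons.1 hpw).2 (by omega)
        (zigzag_tail hlab) (by omega) (by omega) (by omega) (by omega)
      -- As `p + q = h + l - 1`, the sums of opposite ends must grow by one. Removing one more label
      -- from the outer end of the lower block than from that of the upper one does this for the
      -- outer ends; removing `q - t + 1` does it for the inner ends.
      let R : Finset ℤ := Finset.Icc p (p + k) ∪ (insert (q - t + 1) (Finset.Icc (q - k + 1) q))
      have hR : R.card = 2 * k + 2 := by
        rw [Finset.card_union_of_disjoint, Finset.card_insert_of_notMem]
        · simp only [Int.card_Icc]; omega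
        · simp only [Finset.mem_Icc]; omega
        · rw [Finset.disjoint_left]
          intro x
          simp only [Finset.mem_insert, Finset.mem_Icc]
          omega
      have hset : {x : ℤ | -(q - k) ≤ x ∧ x < -(q - k) + (t - k - 1 : ℕ) ∨
          -(p + k + 1) - (t - k - 1 : ℕ) < x ∧ x ≤ -(p + k + 1)} =
          {x | -x ∈ {x : ℤ | p + k + 1 ≤ x ∧ x < p + t ∨ q - t + 1 < x ∧ x ≤ q - k}} := by
        ext x
        simp only [Set.mem_ofPred_eq]
        omega
      rw [hset] at hg
      obtain ⟨g', hg'⟩ := IsDistribution.exists_cons (R := R) (h := h) (lab := lab)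
        hnd.1 (hk.trans hR.symm)
        (by
          intro r
          simp only [R, Finset.mem_union, Finset.mem_insert, Finset.mem_Icc, Set.mem_ofPred_eq]
          omega)
        (by
          intro r
          simp only [R, Finset.mem_union, Finset.mem_insert, Finset.mem_Icc]
          omega)
        ((hlab 0 (by simp)).trans (zigzag_zero h l))
        (by
          intro x
          simp only [Set.mem_ofPred_eq]
          omega) hg
      refine ⟨g', ?_⟩
      convert hg' using 1
      ext x
      simp only [R, Finset.coe_union, Finset.coe_insert, Finset.coe_Icc, Set.mem_union,
        Set.mem_insert_iff, Set.mem_Icc, Set.mem_ofPred_eq]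
      omega

/-- Removing `k + 1` labels below and `k` above leaves an interval whose ends sum to `h + l`, as the
transfer requires; this handles odd numbers of children. Once an even number occurs, all later ones
are even and the remaining interval splits into two equal blocks. -/
theorem exists_distribution (ws : List V) : ∀ (lab : V → ℤ) (h l p q : ℤ),
    ws.Nodup →
    ws.Pairwise (fun v w => (Even (childCount par C v) → Even (childCount par C w)) ∧
      (childCount par C v = 0 → childCount par C w = 0)) →
    ((C.filter fun x => par x ∈ ws).card : ℤ) = q - p + 1 →
    (∀ (j : ℕ) (hj : j < ws.length), lab ws[j] = zigzag h l j) →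
    p + q = h + l - 1 → l ≤ p → q < h →
    ∃ g, IsDistribution par C ws lab h (Set.Icc p q) g := by
  induction ws with
  | nil =>
    intro lab h l p q _ _ _ _ _ _ _
    exact ⟨0, IsDistribution.of_card_eq_zero (by simp)⟩
  | cons w ws ih =>
    intro lab h l p q hnd hpw hcard hlab hpq hlp hqh
    by_cases heven : Even (childCount par C w)
    · have heven' : ∀ v ∈ w :: ws, Even (childCount par C v) := by
        intro v hv
        rcases List.mem_cons.1 hv with rfl | hv
        · exact heven
        · exact ((List.pairwise_cons.1 hpw).1 v hv).1 heven
      obtain ⟨t, ht⟩ := even_card_filter_mem hnd heven'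
      obtain ⟨g, hg⟩ := exists_distribution_of_even (w :: ws) lab h l p q t hnd heven'
        (hpw.imp fun h => h.2) (by omega) hlab hpq hlp hqh (by omega)
      refine ⟨g, ?_⟩
      convert hg using 1
      ext x
      simp only [Set.mem_Icc, Set.mem_ofPred_eq]
      omega
    · rw [List.nodup_cons] at hnd
      obtain ⟨k, hk⟩ := Nat.not_even_iff_odd.1 heven
      rw [card_filter_mem_cons hnd.1, hk] at hcard
      obtain ⟨g, hg⟩ := ih (fun v => - lab v) (-l) (1 - h) (-(q - k)) (-(p + k + 1))
        hnd.2 (List.pairwise_cons.1 hpw).2 (by push_cast at hcard; omega)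
        (zigzag_tail hlab) (by omega) (by omega) (by omega)
      let R : Finset ℤ := Finset.Icc p (p + k) ∪ Finset.Icc (q - k + 1) q
      have hR : R.card = 2 * k + 1 := by
        rw [Finset.card_union_of_disjoint]
        · simp only [Int.card_Icc]; omega
        · rw [Finset.disjoint_left]
          intro x
          simp only [Finset.mem_Icc]
          omega
      have hset : Set.Icc (-(q - k)) (-(p + k + 1)) = {x | -x ∈ Set.Icc (p + k + 1) (q - k)} := by
        ext x
        simp only [Set.mem_ofPred_eq, Set.mem_Icc]
        omega
      rw [hset] at hg
      obtain ⟨g', hg'⟩ := IsDistribution.exists_cons (R := R) (h := h) (lab := lab)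
        hnd.1 (hk.trans hR.symm)
        (by
          intro r
          simp only [R, Finset.mem_union, Finset.mem_Icc, Set.mem_Icc]
          omega)
        (by
          intro r
          simp only [R, Finset.mem_union, Finset.mem_Icc]
          omega)
        ((hlab 0 (by simp)).trans (zigzag_zero h l))
        (by
          intro x
          simp only [Set.mem_Icc]
          omega) hg
      refine ⟨g', ?_⟩
      convert hg' using 1
      ext x
      simp only [R, Finset.coe_union, Finset.coe_Icc, Set.mem_union, Set.mem_Icc]
      omega

theorem exists_sorted_list (par : V → V) (C W : Finset V) : ∃ ws : List V, ws.Nodup ∧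
    (∀ w, w ∈ ws ↔ w ∈ W) ∧ ws.length = W.card ∧
    ws.Pairwise (fun v w => (Even (childCount par C v) → Even (childCount par C w)) ∧
      (childCount par C v = 0 → childCount par C w = 0)) := by
  let key : V → ℕ := fun v =>
    -- Sort order: odd, then positive even, then zero.
    if childCount par C v = 0 then 2 else if Even (childCount par C v) then 1 else 0
  let ws := W.toList.mergeSort fun v w => decide (key v ≤ key w)
  have hperm : ws.Perm W.toList := List.mergeSort_perm _ _
  have hsort : ws.Pairwise fun v w => decide (key v ≤ key w) = true :=
    List.pairwise_mergeSort (by simp; intro a b c h1 h2; exact h1.trans h2)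
      (by simp; intro a b; exact le_total _ _) _
  refine ⟨ws, hperm.nodup_iff.2 W.nodup_toList, fun w => by rw [hperm.mem_iff]; simp,
    by rw [hperm.length_eq]; simp, hsort.imp ?_⟩
  intro v w h
  simp only [decide_eq_true_eq, key] at h
  constructor
  · intro hv
    by_contra hw
    have hw0 : childCount par C w ≠ 0 := fun h0 => hw (by simp [h0])
    simp only [hv, hw, hw0, if_false, if_true] at h
    split_ifs at h <;> omega
  · intro hv
    by_contra hw
    simp only [hv, hw, if_true, if_false] at h
    split_ifs at h <;> omega

/-- A rooted tree of height at most two in which the root has an odd number of children has a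
graceful labeling with the label `0` at the root. -/
theorem exists_isRootLabeling_of_odd {ρ : V} {W : Finset V} (hW : Odd W.card)
    (hparW : ∀ w ∈ W, par w = ρ) (hparC : ∀ x ∈ C, par x ∈ W) (hρW : ρ ∉ W) (hρC : ρ ∉ C)
    (hWC : Disjoint W C) : ∃ f, IsRootLabeling par (insert ρ (W ∪ C)) ρ f := by
  obtain ⟨b, hb⟩ := hW
  obtain ⟨ws, hnd, hmem, hlen, hpw⟩ := exists_sorted_list par C W
  set N := C.card with hN
  set m : ℤ := 2 * b + 1 + N with hm
  let lab : V → ℤ := fun w => zigzag m 1 (ws.idxOf w)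
  have hlab : ∀ (j : ℕ) (hj : j < ws.length), lab ws[j] = zigzag m 1 j := fun j hj => by
    simp only [lab, hnd.idxOf_getElem j hj]
  have hfilter : C.filter (fun x => par x ∈ ws) = C :=
    Finset.filter_true_of_mem fun x hx => (hmem _).2 (hparC x hx)
  -- The `2 * b + 1` centers use `1, …, b` and `m - b, …, m`. The ends of the gap sum to `m = h + l
  -- - 1` because there is one more high center than low ones; this is where oddness enters. The gap
  -- is invariant under `x ↦ m - x`, so the edges below the centers also get labels in the gap,
  -- while the edges at the root get the labels of the centers.
  obtain ⟨g, hg⟩ := exists_distribution ws lab m 1 (b + 1) (m - b - 1) hnd hpw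
    (by rw [hfilter, ← hN]; omega) hlab (by omega) (by omega) (by omega)
  have hidx : ∀ w ∈ W, ws.idxOf w < 2 * b + 1 := fun w hw => by
    rw [← hb, ← hlen]; exact List.idxOf_lt_length_iff.2 ((hmem w).2 hw)
  have blab : ∀ w ∈ W, (1 ≤ lab w ∧ lab w ≤ b) ∨ (m - b ≤ lab w ∧ lab w ≤ m) := fun w hw => by
    have := hidx w hw
    simp only [lab, zigzag]
    split_ifs <;> omega
  have lab_inj : ∀ v ∈ W, ∀ w ∈ W, lab v = lab w → v = w := fun v hv w hw h => by
    have h1 := hidx v hv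
    have h2 := hidx w hw
    have h3 : ws.idxOf v = ws.idxOf w := by
      simp only [lab, zigzag] at h
      split_ifs at h <;> omega
    exact (List.idxOf_inj ((hmem v).2 hv)).1 h3
  have bg : ∀ x ∈ C, b + 1 ≤ g x ∧ g x ≤ m - b - 1 := fun x hx =>
    hg.mem x hx ((hmem _).2 (hparC x hx))
  have bd : ∀ x ∈ C, b + 1 ≤ m - |g x - lab (par x)| ∧ m - |g x - lab (par x)| ≤ m - b - 1 :=
    fun x hx => hg.diff_mem x hx ((hmem _).2 (hparC x hx))
  have hWne : ∀ w ∈ W, w ≠ ρ := fun w hw h => hρW (h ▸ hw)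
  have hCne : ∀ x ∈ C, x ≠ ρ := fun x hx h => hρC (h ▸ hx)
  have hCW : ∀ x ∈ C, x ∉ W := fun x hx h => Finset.disjoint_left.1 hWC h hx
  let F : V → ℤ := fun x => if x = ρ then 0 else if x ∈ W then lab x else g x
  have Fρ : F ρ = 0 := by simp [F]
  have FW : ∀ w ∈ W, F w = lab w := fun w hw => by simp [F, hWne w hw, hw]
  have FC : ∀ x ∈ C, F x = g x := fun x hx => by simp [F, hCne x hx, hCW x hx]
  have DW : ∀ w ∈ W, |F w - F (par w)| = lab w := fun w hw => by
    rw [FW w hw, hparW w hw, Fρ, sub_zero, abs_of_nonneg]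
    have := blab w hw; omega
  have DC : ∀ x ∈ C, |F x - F (par x)| = |g x - lab (par x)| := fun x hx => by
    rw [FC x hx, FW _ (hparC x hx)]
  have hcard : ((insert ρ (W ∪ C)).card : ℤ) = m + 1 := by
    rw [Finset.card_insert_of_notMem (by simp [hρW, hρC]), Finset.card_union_of_disjoint hWC]
    push_cast; omega
  refine ⟨F, by simp, Fρ, ?_, ?_, ?_, ?_, ?_⟩
  · intro x hx hxρ
    simp only [Finset.mem_insert, Finset.mem_union] at hx ⊢
    rcases hx with rfl | hx | hx
    · exact absurd rfl hxρ
    · exact Or.inl (hparW x hx)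
    · exact Or.inr (Or.inl (hparC x hx))
  · intro x hx
    simp only [Finset.mem_insert, Finset.mem_union] at hx
    rcases hx with rfl | hx | hx
    · rw [Fρ]
    · rw [FW x hx]; have := blab x hx; omega
    · rw [FC x hx]; have := bg x hx; omega
  · intro x hx
    rw [hcard]
    simp only [Finset.mem_insert, Finset.mem_union] at hx
    rcases hx with rfl | hx | hx
    · rw [Fρ]; omega
    · rw [FW x hx]; have := blab x hx; omega
    · rw [FC x hx]; have := bg x hx; omega
  · intro x hx y hy hxy
    simp only [Finset.mem_insert, Finset.mem_union] at hx hy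
    rcases hx with rfl | hx | hx <;> rcases hy with rfl | hy | hy
    · rfl
    · rw [Fρ, FW y hy] at hxy; have := blab y hy; omega
    · rw [Fρ, FC y hy] at hxy; have := bg y hy; omega
    · rw [Fρ, FW x hx] at hxy; have := blab x hx; omega
    · rw [FW x hx, FW y hy] at hxy; exact lab_inj x hx y hy hxy
    · rw [FW x hx, FC y hy] at hxy; have := blab x hx; have := bg y hy; omega
    · rw [Fρ, FC x hx] at hxy; have := bg x hx; omega
    · rw [FC x hx, FW y hy] at hxy; have := blab y hy; have := bg x hx; omega
    · rw [FC x hx, FC y hy] at hxy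
      exact hg.inj x hx ((hmem _).2 (hparC x hx)) y hy ((hmem _).2 (hparC y hy)) hxy
  · intro x hx hxρ y hy hyρ hxy
    replace hx := Finset.mem_of_mem_insert_of_ne hx hxρ
    replace hy := Finset.mem_of_mem_insert_of_ne hy hyρ
    rw [Finset.mem_union] at hx hy
    rcases hx with hx | hx <;> rcases hy with hy | hy
    · rw [DW x hx, DW y hy] at hxy; exact lab_inj x hx y hy hxy
    · rw [DW x hx, DC y hy] at hxy; have := blab x hx; have := bd y hy; omega
    · rw [DC x hx, DW y hy] at hxy; have := blab y hy; have := bd x hx; omega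
    · rw [DC x hx, DC y hy] at hxy
      exact hg.diff x hx ((hmem _).2 (hparC x hx)) y hy ((hmem _).2 (hparC y hy)) hxy

end Distribution

/-! ### Leveled trees: cores of lobes and assembly along the spine -/

/-- A rooted presentation of a lobster: `v 0, …, v (r - 1)` is the spine, with root `v 0`, `idx x`
is the index of the lobe of `x`, and `lvl x` is the distance of `x` from the spine. -/
structure IsLeveled {V : Type*} (par : V → V) (r : ℕ) (v : ℕ → V) (idx lvl : V → ℕ) : Prop where
  idx_lt : ∀ x, idx x < r
  lvl_le : ∀ x, lvl x ≤ 2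
  idx_v : ∀ i < r, idx (v i) = i
  lvl_v : ∀ i < r, lvl (v i) = 0
  eq_v : ∀ x, lvl x = 0 → x = v (idx x)
  lvl_par : ∀ x, lvl x ≠ 0 → lvl (par x) + 1 = lvl x
  idx_par : ∀ x, lvl x ≠ 0 → idx (par x) = idx x
  par_v : ∀ i, i + 1 < r → par (v (i + 1)) = v i

theorem Finset.exists_bijOn_of_card_eq {V : Type*} {A B : Finset V} (h : A.card = B.card) :
    ∃ e : V → V, Set.BijOn e A B := by
  classical
  let e := Finset.equivOfCardEq h
  refine ⟨fun x => if hx : x ∈ A then e ⟨x, hx⟩ else x, ?_, ?_, ?_⟩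
  · intro x hx
    have hx' : x ∈ A := hx
    simp [hx']
  · intro x hx y hy hxy
    have hx' : x ∈ A := hx
    have hy' : y ∈ A := hy
    simp only [hx', hy', dif_pos] at hxy
    simpa using e.injective (Subtype.ext hxy)
  · intro y hy
    refine ⟨e.symm ⟨y, hy⟩, (e.symm ⟨y, hy⟩).2, ?_⟩
    simp

namespace IsLeveled

variable {V : Type*} [Fintype V]

/-- The vertices of the `i`-th lobe at level `j`. -/
def nodes (idx lvl : V → ℕ) (i j : ℕ) : Finset V :=
  Finset.univ.filter fun x => idx x = i ∧ lvl x = j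

@[simp]
theorem mem_nodes {idx lvl : V → ℕ} {i j : ℕ} {x : V} :
    x ∈ nodes idx lvl i j ↔ idx x = i ∧ lvl x = j := by
  simp [nodes]

theorem par_of_mem_nodes_one {par : V → V} {r : ℕ} {v : ℕ → V} {idx lvl : V → ℕ}
    (hL : IsLeveled par r v idx lvl) {i : ℕ} {w : V} (hw : w ∈ nodes idx lvl i 1) : par w = v i := by
  have h1 := mem_nodes.1 hw
  have h0 : lvl w ≠ 0 := by omega
  have h2 := hL.lvl_par w h0
  rw [hL.eq_v (par w) (by omega), hL.idx_par w h0, h1.1]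

variable [DecidableEq V]

/-- The centers in the `i`-th lobe which have at least one child. -/
def essential (par : V → V) (idx lvl : V → ℕ) (i : ℕ) : Finset V :=
  (nodes idx lvl i 1).filter fun w => ∃ x, lvl x = 2 ∧ par x = w

@[simp]
theorem mem_essential {par : V → V} {idx lvl : V → ℕ} {i : ℕ} {w : V} :
    w ∈ essential par idx lvl i ↔
      (idx w = i ∧ lvl w = 1) ∧ ∃ x, lvl x = 2 ∧ par x = w := by
  simp [essential]

/-- The children at level two. -/
def kids (par : V → V) (lvl : V → ℕ) (w : V) : Finset V :=
  Finset.univ.filter fun x => lvl x = 2 ∧ par x = w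

@[simp]
theorem mem_kids {par : V → V} {lvl : V → ℕ} {w x : V} :
    x ∈ kids par lvl w ↔ lvl x = 2 ∧ par x = w := by
  simp [kids]

variable {par : V → V} {r : ℕ} {v : ℕ → V} {idx lvl : V → ℕ}

theorem par_mem_essential (hL : IsLeveled par r v idx lvl) {i : ℕ} {x : V}
    (hx : x ∈ nodes idx lvl i 2) : par x ∈ essential par idx lvl i := by
  rw [mem_nodes] at hx
  have h0 : lvl x ≠ 0 := by omega
  have h1 := hL.lvl_par x h0
  exact mem_essential.2 ⟨⟨(hL.idx_par x h0).trans hx.1, by omega⟩, x, hx.2, rfl⟩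

theorem exists_core (hpend : ∀ i < r, Even (essential par idx lvl i).card →
      (essential par idx lvl i).card ≠ 0 → ∃ u ∈ nodes idx lvl i 1, u ∉ essential par idx lvl i)
    {i : ℕ} (hi : i < r) :
    ∃ W, essential par idx lvl i ⊆ W ∧ W ⊆ nodes idx lvl i 1 ∧ (Odd W.card ∨ W = ∅) := by
  by_cases h1 : Odd (essential par idx lvl i).card ∨ essential par idx lvl i = ∅
  · exact ⟨_, subset_rfl, Finset.filter_subset _ _, h1⟩
  · rw [not_or, Nat.not_odd_iff_even, ← Finset.card_eq_zero] at h1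
    obtain ⟨u, hu, hu'⟩ := hpend i hi h1.1 h1.2
    refine ⟨insert u (essential par idx lvl i), Finset.subset_insert _ _, ?_, Or.inl ?_⟩
    · exact Finset.insert_subset hu (Finset.filter_subset _ _)
    · rw [Finset.card_insert_of_notMem hu']
      exact h1.1.add_one

/-- When the common number of essential branches is even and non-zero, one pendant vertex is added
on each side. The two are matched with each other, both having no children. -/
theorem exists_core_pair (hpend : ∀ i < r, Even (essential par idx lvl i).card →
      (essential par idx lvl i).card ≠ 0 → ∃ u ∈ nodes idx lvl i 1, u ∉ essential par idx lvl i)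
    {i j : ℕ} (hi : i < r) (hj : j < r) {ψ : V → V}
    (hψ : Set.BijOn ψ (essential par idx lvl i) (essential par idx lvl j))
    (hkids : ∀ w ∈ essential par idx lvl i, (kids par lvl (ψ w)).card = (kids par lvl w).card) :
    ∃ W W' : Finset V, ∃ χ : V → V, essential par idx lvl i ⊆ W ∧ W ⊆ nodes idx lvl i 1 ∧
      essential par idx lvl j ⊆ W' ∧ W' ⊆ nodes idx lvl j 1 ∧ (Odd W.card ∨ W = ∅) ∧
      Set.BijOn χ W W' ∧ ∀ w ∈ W, (kids par lvl (χ w)).card = (kids par lvl w).card := by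
  by_cases h1 : Odd (essential par idx lvl i).card ∨ essential par idx lvl i = ∅
  · exact ⟨_, _, ψ, subset_rfl, Finset.filter_subset _ _, subset_rfl, Finset.filter_subset _ _,
      h1, hψ, hkids⟩
  · rw [not_or, Nat.not_odd_iff_even, ← Finset.card_eq_zero] at h1
    have h2 : (essential par idx lvl i).card = (essential par idx lvl j).card :=
      Finset.card_bij (fun x _ => ψ x) (fun x hx => hψ.1 hx) (fun x hx y hy h => hψ.2.1 hx hy h)
        (fun y hy => by obtain ⟨x, hx, h⟩ := hψ.2.2 hy; exact ⟨x, hx, h⟩)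
    obtain ⟨u, hu, hu'⟩ := hpend i hi h1.1 h1.2
    obtain ⟨u', hu1, hu1'⟩ := hpend j hj (h2 ▸ h1.1) (h2 ▸ h1.2)
    have hne : ∀ w ∈ essential par idx lvl i, w ≠ u := fun w hw h => hu' (h ▸ hw)
    have hzero : ∀ k u, u ∈ nodes idx lvl k 1 → u ∉ essential par idx lvl k →
        kids par lvl u = ∅ := by
      intro k u h1 h2
      rw [Finset.eq_empty_iff_forall_notMem]
      intro x hx
      exact h2 (mem_essential.2 ⟨mem_nodes.1 h1, x, mem_kids.1 hx⟩)
    refine ⟨insert u (essential par idx lvl i), insert u' (essential par idx lvl j),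
      fun x => if x = u then u' else ψ x, Finset.subset_insert _ _,
      Finset.insert_subset hu (Finset.filter_subset _ _), Finset.subset_insert _ _,
      Finset.insert_subset hu1 (Finset.filter_subset _ _), Or.inl ?_, ⟨?_, ?_, ?_⟩, ?_⟩
    · rw [Finset.card_insert_of_notMem hu']
      exact h1.1.add_one
    · intro x hx
      rw [Finset.coe_insert, Set.mem_insert_iff] at hx ⊢
      rcases hx with rfl | hx
      · simp
      · simp only [hne x hx, if_false]
        exact Or.inr (hψ.1 hx)
    · intro x hx y hy hxy
      rw [Finset.coe_insert, Set.mem_insert_iff] at hx hy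
      rcases hx with rfl | hx <;> rcases hy with rfl | hy
      · rfl
      · simp only [hne y hy, if_false, if_true] at hxy
        exact absurd (hψ.1 hy) (by rw [← hxy]; exact hu1')
      · simp only [hne x hx, if_false, if_true] at hxy
        exact absurd (hψ.1 hx) (by rw [hxy]; exact hu1')
      · simp only [hne x hx, hne y hy, if_false] at hxy
        exact hψ.2.1 hx hy hxy
    · intro y hy
      rw [Finset.coe_insert, Set.mem_insert_iff] at hy
      rcases hy with rfl | hy
      · exact ⟨u, by simp, by simp⟩
      · obtain ⟨x, hx, rfl⟩ := hψ.2.2 hy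
        exact ⟨x, by simpa using Or.inr (by simpa using hx), by simp [hne x hx]⟩
    · intro w hw
      rcases Finset.mem_insert.1 hw with rfl | hw
      · simp only [if_true]
        rw [hzero _ _ hu hu', hzero _ _ hu1 hu1']
      · simp only [hne w hw, if_false]
        exact hkids w hw

theorem exists_core_labeling (hL : IsLeveled par r v idx lvl) {i : ℕ} (hi : i < r) {W : Finset V}
    (hW1 : essential par idx lvl i ⊆ W) (hW2 : W ⊆ nodes idx lvl i 1)
    (hW3 : Odd W.card ∨ W = ∅) :
    ∃ f, IsRootLabeling par (insert (v i) (W ∪ nodes idx lvl i 2)) (v i) f := by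
  have hparC : ∀ x ∈ nodes idx lvl i 2, par x ∈ W := fun x hx =>
    hW1 (hL.par_mem_essential hx)
  rcases hW3 with hodd | rfl
  · refine exists_isRootLabeling_of_odd hodd ?_ hparC ?_ ?_ ?_
    · exact fun w hw => hL.par_of_mem_nodes_one (hW2 hw)
    · intro h
      have h1 := mem_nodes.1 (hW2 h)
      have := hL.lvl_v i hi
      omega
    · intro h
      have h1 := mem_nodes.1 h
      have := hL.lvl_v i hi
      omega
    · rw [Finset.disjoint_left]
      intro x hx hx'
      have h1 := mem_nodes.1 (hW2 hx)
      have h2 := mem_nodes.1 hx'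
      omega
  · have h1 : nodes idx lvl i 2 = ∅ := by
      rw [Finset.eq_empty_iff_forall_notMem]
      intro x hx
      simpa using hparC x hx
    rw [h1]
    exact ⟨_, by simpa using IsRootLabeling.singleton par (v i)⟩

/-- The bijection of centers extends to the core by choosing, for each center, a bijection between
its children and those of the corresponding center. -/
theorem exists_copy (hL : IsLeveled par r v idx lvl) {i j : ℕ} (hi : i < r) (hj : j < r)
    {W W' : Finset V} {χ : V → V} (hW1 : essential par idx lvl i ⊆ W)
    (hW2 : W ⊆ nodes idx lvl i 1) (hW1' : essential par idx lvl j ⊆ W')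
    (hW2' : W' ⊆ nodes idx lvl j 1) (hχ : Set.BijOn χ W W')
    (hkids : ∀ w ∈ W, (kids par lvl (χ w)).card = (kids par lvl w).card) :
    ∃ φ : V → V, Set.InjOn φ (insert (v i) (W ∪ nodes idx lvl i 2) : Finset V) ∧ φ (v i) = v j ∧
      (insert (v i) (W ∪ nodes idx lvl i 2)).image φ = insert (v j) (W' ∪ nodes idx lvl j 2) ∧
      (∀ x ∈ insert (v i) (W ∪ nodes idx lvl i 2), lvl (φ x) = lvl x) ∧
      ∀ x ∈ insert (v i) (W ∪ nodes idx lvl i 2), x ≠ v i → par (φ x) = φ (par x) := by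
  have hparC : ∀ x ∈ nodes idx lvl i 2, par x ∈ W := fun x hx =>
    hW1 (hL.par_mem_essential hx)
  have hparC' : ∀ x ∈ nodes idx lvl j 2, par x ∈ W' := fun x hx =>
    hW1' (hL.par_mem_essential hx)
  have hex : ∀ w, ∃ e : V → V, w ∈ W → Set.BijOn e (kids par lvl w) (kids par lvl (χ w)) := by
    intro w
    by_cases hw : w ∈ W
    · obtain ⟨e, he⟩ := Finset.exists_bijOn_of_card_eq (hkids w hw).symm
      exact ⟨e, fun _ => he⟩
    · exact ⟨id, fun h => absurd h hw⟩
  choose e he using hex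
  let φ : V → V := fun x => if lvl x = 0 then v j else if lvl x = 1 then χ x else e (par x) x
  have lW : ∀ x ∈ W, lvl x = 1 := fun x hx => (mem_nodes.1 (hW2 hx)).2
  have lW' : ∀ x ∈ W', lvl x = 1 := fun x hx => (mem_nodes.1 (hW2' hx)).2
  have φ0 : φ (v i) = v j := by simp [φ, hL.lvl_v i hi]
  have φ1 : ∀ x ∈ W, φ x = χ x := fun x hx => by simp [φ, lW x hx]
  have φ2 : ∀ x ∈ nodes idx lvl i 2, φ x = e (par x) x := fun x hx => by
    simp [φ, (mem_nodes.1 hx).2]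
  have m2 : ∀ x ∈ nodes idx lvl i 2, lvl (φ x) = 2 ∧ par (φ x) = χ (par x) := by
    intro x hx
    have h1 : e (par x) x ∈ kids par lvl (χ (par x)) := (he _ (hparC x hx)).1
      (show x ∈ kids par lvl (par x) from mem_kids.2 ⟨(mem_nodes.1 hx).2, rfl⟩)
    rw [φ2 x hx]
    exact mem_kids.1 h1
  have mχ : ∀ x ∈ W, χ x ∈ W' := fun x hx => hχ.1 hx
  have hlvl : ∀ x ∈ insert (v i) (W ∪ nodes idx lvl i 2), lvl (φ x) = lvl x := by
    intro x hx
    simp only [Finset.mem_insert, Finset.mem_union] at hx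
    rcases hx with rfl | hx | hx
    · rw [φ0, hL.lvl_v i hi, hL.lvl_v j hj]
    · rw [φ1 x hx, lW x hx, lW' _ (mχ x hx)]
    · rw [(m2 x hx).1, (mem_nodes.1 hx).2]
  refine ⟨φ, ?_, φ0, ?_, hlvl, ?_⟩
  · intro x hx y hy hxy
    have hx0 := hlvl x hx
    have hy0 := hlvl y hy
    rw [hxy] at hx0
    have h0 := hL.lvl_v i hi
    rw [Finset.mem_coe] at hx hy
    simp only [Finset.mem_insert, Finset.mem_union] at hx hy
    rcases hx with rfl | hx | hx <;> rcases hy with rfl | hy | hy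
    · rfl
    · have := lW y hy; omega
    · have := (mem_nodes.1 hy).2; omega
    · have := lW x hx; omega
    · rw [φ1 x hx, φ1 y hy] at hxy
      exact hχ.2.1 hx hy hxy
    · have := lW x hx; have := (mem_nodes.1 hy).2; omega
    · have := (mem_nodes.1 hx).2; omega
    · have := lW y hy; have := (mem_nodes.1 hx).2; omega
    · have h1 : par x = par y := by
        refine hχ.2.1 (hparC x hx) (hparC y hy) ?_
        rw [← (m2 x hx).2, ← (m2 y hy).2, hxy]
      rw [φ2 x hx, φ2 y hy, h1] at hxy
      refine (he _ (hparC y hy)).2.1 ?_ ?_ hxy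
      · exact mem_kids.2 ⟨(mem_nodes.1 hx).2, h1⟩
      · exact mem_kids.2 ⟨(mem_nodes.1 hy).2, rfl⟩
  · ext y
    simp only [Finset.mem_image, Finset.mem_insert, Finset.mem_union]
    constructor
    · rintro ⟨x, rfl | hx | hx, rfl⟩
      · exact Or.inl φ0
      · rw [φ1 x hx]; exact Or.inr (Or.inl (mχ x hx))
      · have h1 := m2 x hx
        have h2 := hL.idx_par (φ x) (by omega)
        rw [h1.2, (mem_nodes.1 (hW2' (mχ _ (hparC x hx)))).1] at h2
        exact Or.inr (Or.inr (mem_nodes.2 ⟨h2.symm, h1.1⟩))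
    · rintro (rfl | hy | hy)
      · exact ⟨v i, Or.inl rfl, φ0⟩
      · obtain ⟨x, hx, rfl⟩ := hχ.2.2 hy
        exact ⟨x, Or.inr (Or.inl hx), φ1 x hx⟩
      · obtain ⟨w, hw, hwy⟩ := hχ.2.2 (hparC' y hy)
        obtain ⟨x, hx, hxy⟩ := (he w hw).2.2
          (show y ∈ kids par lvl (χ w) from mem_kids.2 ⟨(mem_nodes.1 hy).2, hwy.symm⟩)
        have h1 := mem_kids.1 (Finset.mem_coe.1 hx)
        have h2 := hL.idx_par x (by omega)
        rw [h1.2, (mem_nodes.1 (hW2 hw)).1] at h2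
        have h3 : x ∈ nodes idx lvl i 2 := mem_nodes.2 ⟨h2.symm, h1.1⟩
        exact ⟨x, Or.inr (Or.inr h3), by rw [φ2 x h3, h1.2, hxy]⟩
  · intro x hx hxi
    simp only [Finset.mem_insert, Finset.mem_union] at hx
    rcases hx with rfl | hx | hx
    · exact absurd rfl hxi
    · rw [φ1 x hx, hL.par_of_mem_nodes_one (hW2' (mχ x hx)), hL.par_of_mem_nodes_one (hW2 hx), φ0]
    · rw [(m2 x hx).2, φ1 _ (hparC x hx)]

theorem exists_labeling_single (hL : IsLeveled par r v idx lvl)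
    (hpend : ∀ i < r, Even (essential par idx lvl i).card →
      (essential par idx lvl i).card ≠ 0 → ∃ u ∈ nodes idx lvl i 1, u ∉ essential par idx lvl i)
    {i : ℕ} (hi : i + 1 = r) :
    ∃ f, IsRootLabeling par (Finset.univ.filter fun x => i ≤ idx x) (v i) f := by
  obtain ⟨W, hW1, hW2, hW3⟩ := exists_core hpend (show i < r by omega)
  have h1 := IsRootLabeling.exists_union_leaves
    (hL.exists_core_labeling (by omega) hW1 hW2 hW3) (nodes idx lvl i 1 \ W) ?_
  · convert h1 using 3
    ext x
    simp only [Finset.mem_filter, Finset.mem_univ, true_and, Finset.mem_union, Finset.mem_sdiff,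
      Finset.mem_insert, mem_nodes]
    constructor
    · intro hx
      have h2 : idx x = i := by have := hL.idx_lt x; omega
      have h3 := hL.lvl_le x
      have h4 := hL.eq_v x
      rw [h2] at h4
      have h5 : lvl x = 0 ∨ lvl x = 1 ∨ lvl x = 2 := by omega
      rcases h5 with h5 | h5 | h5
      · exact Or.inr (Or.inl (h4 h5))
      · by_cases h6 : x ∈ W
        · exact Or.inr (Or.inr (Or.inl h6))
        · exact Or.inl ⟨⟨h2, h5⟩, h6⟩
      · exact Or.inr (Or.inr (Or.inr ⟨h2, h5⟩))
    · have h2 := hL.idx_v i (by omega)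
      have h3 : x ∈ W → idx x = i := fun h => (mem_nodes.1 (hW2 h)).1
      rintro (⟨h, _⟩ | rfl | h | h)
      · omega
      · omega
      · have := h3 h; omega
      · omega
  · exact fun w hw => hL.par_of_mem_nodes_one (Finset.mem_sdiff.1 hw).1

/-- The rest of the tree is hung below `v (i + 1)` and joined by the spare pendant vertices there;
this is the hanging tree in `exists_glue`. The spare pendant vertices at `v i` are attached after
gluing, when `v i` is the root. -/
theorem exists_labeling_pair (hL : IsLeveled par r v idx lvl)
    (hpend : ∀ i < r, Even (essential par idx lvl i).card →
      (essential par idx lvl i).card ≠ 0 → ∃ u ∈ nodes idx lvl i 1, u ∉ essential par idx lvl i)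
    {i : ℕ} (hi : i + 1 < r) {ψ : V → V}
    (hψ : Set.BijOn ψ (essential par idx lvl i) (essential par idx lvl (i + 1)))
    (hkids : ∀ w ∈ essential par idx lvl i, (kids par lvl (ψ w)).card = (kids par lvl w).card)
    (hrest : i + 2 < r →
      ∃ f, IsRootLabeling par (Finset.univ.filter fun x => i + 2 ≤ idx x) (v (i + 2)) f) :
    ∃ f, IsRootLabeling par (Finset.univ.filter fun x => i ≤ idx x) (v i) f := by
  obtain ⟨W, W', χ, hW1, hW2, hW1', hW2', hodd, hχ, hkids'⟩ :=
    exists_core_pair hpend (show i < r by omega) hi hψ hkids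
  obtain ⟨f, hf⟩ := hL.exists_core_labeling (by omega) hW1 hW2 hodd
  obtain ⟨φ, hφinj, hφv, hφim, hφlvl, hφpar⟩ :=
    hL.exists_copy (show i < r by omega) hi hW1 hW2 hW1' hW2' hχ hkids'
  have hvi := hL.idx_v i (by omega)
  have hvi' := hL.lvl_v i (by omega)
  have hvj := hL.idx_v (i + 1) hi
  have hvj' := hL.lvl_v (i + 1) hi
  have hinner : ∃ h, IsRootLabeling par
      (insert (v (i + 1)) (Finset.univ.filter fun x => i + 2 ≤ idx x)) (v (i + 1)) h := by
    by_cases h2 : i + 2 < r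
    · obtain ⟨g, hg⟩ := hrest h2
      refine ⟨_, hg.insert_root ?_ (hL.par_v (i + 1) h2)⟩
      simp only [Finset.mem_filter, Finset.mem_univ, true_and]
      omega
    · have h3 : (Finset.univ.filter fun x => i + 2 ≤ idx x) = ∅ := by
        rw [Finset.filter_eq_empty_iff]
        intro x _
        have := hL.idx_lt x
        omega
      rw [h3]
      exact ⟨_, by simpa using IsRootLabeling.singleton par (v (i + 1))⟩
  obtain ⟨h, hh⟩ := IsRootLabeling.exists_union_leaves hinner (nodes idx lvl (i + 1) 1 \ W')
    (fun w hw => hL.par_of_mem_nodes_one (Finset.mem_sdiff.1 hw).1)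
  have hT : ∀ x ∈ insert (v i) (W ∪ nodes idx lvl i 2), idx x = i := by
    intro x hx
    simp only [Finset.mem_insert, Finset.mem_union] at hx
    rcases hx with rfl | hx | hx
    · exact hvi
    · exact (mem_nodes.1 (hW2 hx)).1
    · exact (mem_nodes.1 hx).1
  have hT' : ∀ x ∈ insert (v i) (W ∪ nodes idx lvl i 2),
      idx (φ x) = i + 1 ∧ (lvl x = 1 → φ x ∈ W') := by
    intro x hx
    have h1 := Finset.mem_image_of_mem φ hx
    rw [hφim] at h1
    simp only [Finset.mem_insert, Finset.mem_union] at h1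
    have h2 := hφlvl x hx
    rcases h1 with h1 | h1 | h1
    · rw [h1] at h2 ⊢
      exact ⟨hvj, fun h3 => by omega⟩
    · exact ⟨(mem_nodes.1 (hW2' h1)).1, fun _ => h1⟩
    · have h3 := mem_nodes.1 h1
      exact ⟨h3.1, fun h4 => by omega⟩
  have hI : ∀ x ∈ (nodes idx lvl (i + 1) 1 \ W') ∪
      insert (v (i + 1)) (Finset.univ.filter fun x => i + 2 ≤ idx x),
      (idx x = i + 1 ∧ lvl x = 1 ∧ x ∉ W') ∨ x = v (i + 1) ∨ i + 2 ≤ idx x := by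
    intro x hx
    simp only [Finset.mem_union, Finset.mem_sdiff, mem_nodes, Finset.mem_insert,
      Finset.mem_filter, Finset.mem_univ, true_and] at hx
    tauto
  have hlv0 : ∀ x, idx x = i → lvl x = 0 → x = v i := fun x h1 h2 => by
    rw [hL.eq_v x h2, h1]
  -- Level one is the upper side. Lobe indices separate the first core from the rest, and the
  -- hanging tree meets the second core only in `v (i + 1)`, since its pendant vertices lie outside
  -- `W'`.
  have hglue := IsRootLabeling.exists_glue (upper := fun x => lvl x = 1) hf hh hφinj hφv hφpar
    (by
      intro x hx hxv
      have h0 : lvl x ≠ 0 := fun h0 => hxv (hlv0 x (hT x hx) h0)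
      have h1 := hL.lvl_par x h0
      have h2 := hL.lvl_le x
      omega)
    (by omega) (hL.par_v i hi)
    (by
      rw [Finset.disjoint_left]
      intro x hx hx'
      have h1 := hT x hx
      rcases hI x hx' with h2 | h2 | h2
      · omega
      · rw [h2] at h1; omega
      · omega)
    (by
      intro x hx y hy hxy
      have h1 := hT x hx
      have h2 := (hT' y hy).1
      rw [← hxy] at h2
      omega)
    (by
      intro x hx y hy hxy
      have h1 := hT' y hy
      have h2 := hφlvl y hy
      rw [← hxy] at h1 h2
      refine hlv0 y (hT y hy) ?_
      rcases hI x hx with h3 | h3 | h3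
      · exact absurd (h1.2 (by omega)) h3.2.2
      · rw [h3] at h2; omega
      · omega)
  have h1 := IsRootLabeling.exists_union_leaves hglue (nodes idx lvl i 1 \ W)
    (fun w hw => hL.par_of_mem_nodes_one (Finset.mem_sdiff.1 hw).1)
  convert h1 using 3
  rw [hφim]
  have e1 : ∀ x, x ∈ W → idx x = i := fun x h => (mem_nodes.1 (hW2 h)).1
  have e2 : ∀ x, x ∈ W' → idx x = i + 1 := fun x h => (mem_nodes.1 (hW2' h)).1
  ext x
  simp only [Finset.mem_filter, Finset.mem_univ, true_and, Finset.mem_union, Finset.mem_sdiff,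
    Finset.mem_insert, mem_nodes]
  constructor
  · intro hx
    have h3 := hL.lvl_le x
    have h4 := hL.eq_v x
    have h5 : lvl x = 0 ∨ lvl x = 1 ∨ lvl x = 2 := by omega
    have h6 : idx x = i ∨ idx x = i + 1 ∨ i + 2 ≤ idx x := by omega
    rcases h6 with h6 | h6 | h6
    · rw [h6] at h4
      rcases h5 with h5 | h5 | h5
      · exact Or.inr (Or.inl (Or.inl (h4 h5)))
      · by_cases h7 : x ∈ W
        · exact Or.inr (Or.inl (Or.inr (Or.inl h7)))
        · exact Or.inl ⟨⟨h6, h5⟩, h7⟩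
      · exact Or.inr (Or.inl (Or.inr (Or.inr ⟨h6, h5⟩)))
    · rw [h6] at h4
      rcases h5 with h5 | h5 | h5
      · exact Or.inr (Or.inr (Or.inl (Or.inl (h4 h5))))
      · by_cases h7 : x ∈ W'
        · exact Or.inr (Or.inr (Or.inl (Or.inr (Or.inl h7))))
        · exact Or.inr (Or.inr (Or.inr (Or.inl ⟨⟨h6, h5⟩, h7⟩)))
      · exact Or.inr (Or.inr (Or.inl (Or.inr (Or.inr ⟨h6, h5⟩))))
    · exact Or.inr (Or.inr (Or.inr (Or.inr (Or.inr h6))))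
  · have e1' := e1 x
    have e2' := e2 x
    rintro (⟨⟨h, _⟩, _⟩ | (rfl | h | ⟨h, _⟩) | (rfl | h | ⟨h, _⟩) | ⟨⟨h, _⟩, _⟩ | rfl | h)
    · omega
    · omega
    · have := e1' h; omega
    · omega
    · omega
    · have := e2' h; omega
    · omega
    · omega
    · omega
    · omega

theorem exists_labeling (hL : IsLeveled par r v idx lvl) (hr : 0 < r)
    (hpend : ∀ i < r, Even (essential par idx lvl i).card →
      (essential par idx lvl i).card ≠ 0 → ∃ u ∈ nodes idx lvl i 1, u ∉ essential par idx lvl i)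
    (hsim : ∀ k, 2 * k + 1 < r → ∃ ψ : V → V,
      Set.BijOn ψ (essential par idx lvl (2 * k)) (essential par idx lvl (2 * k + 1)) ∧
      ∀ w ∈ essential par idx lvl (2 * k),
        (kids par lvl (ψ w)).card = (kids par lvl w).card) :
    ∃ f, IsRootLabeling par Finset.univ (v 0) f := by
  have key : ∀ n k, r - 2 * k = n → 2 * k < r →
      ∃ f, IsRootLabeling par (Finset.univ.filter fun x => 2 * k ≤ idx x) (v (2 * k)) f := by
    intro n
    induction n using Nat.strong_induction_on with
    | _ n ih =>
      intro k hn hk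
      by_cases h1 : 2 * k + 1 = r
      · exact hL.exists_labeling_single hpend h1
      · obtain ⟨ψ, hψ, hkids⟩ := hsim k (by omega)
        exact hL.exists_labeling_pair hpend (by omega) hψ hkids
          fun h2 => ih (r - 2 * (k + 1)) (by omega) (k + 1) rfl (by omega)
  simpa using key _ 0 rfl (by omega)

end IsLeveled

/-! ### Rooting a lobster -/

namespace Lobster

variable {V : Type*} {r : ℕ}

theorem exists_center (L : Lobster V r) {x : V} (hx : x ∉ Set.range L.vertex)
    (hx1 : ¬ ∃ i, L.graph.Adj (L.vertex i) x) :
    ∃ u, L.graph.Adj u x ∧ ∃ i, L.graph.Adj (L.vertex i) u := by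
  obtain ⟨i, hi⟩ := L.near_spine x
  obtain ⟨p, hp⟩ := L.isTree.connected.exists_walk_length_eq_dist (L.vertex i) x
  rw [← hp] at hi
  match p, hi with
  | .nil, _ => exact absurd ⟨i, rfl⟩ hx
  | .cons h .nil, _ => exact absurd ⟨i, h⟩ hx1
  | .cons (v := u) h (.cons h' .nil), _ => exact ⟨u, h', i, h⟩
  | .cons _ (.cons _ (.cons _ _)), hi => simp at hi

theorem pos (L : Lobster V r) : 0 < r := by
  obtain ⟨x⟩ := L.isTree.connected.nonempty
  obtain ⟨i, -⟩ := L.near_spine x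
  exact i.pos

/-- If every vertex but one is adjacent to its parent, and the parent has a smaller rank, then the
tree has no other edges. -/
theorem _root_.SimpleGraph.IsTree.adj_iff_of_parent [Finite V] {G : SimpleGraph V} (hG : G.IsTree)
    {ρ : V} {par : V → V} {rank : V → ℕ} (hadj : ∀ x, x ≠ ρ → G.Adj x (par x))
    (hrank : ∀ x, x ≠ ρ → rank (par x) < rank x) (a b : V) :
    G.Adj a b ↔ (a ≠ ρ ∧ par a = b) ∨ (b ≠ ρ ∧ par b = a) := by
  classical
  have := Fintype.ofFinite V
  constructor
  · intro hab
    -- The pairs `s(x, par x)` with `x ≠ ρ` are distinct, since two vertices cannot each have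
    -- smaller rank than the other. They number one less than the vertices, hence are all the edges
    -- of the tree.
    let E : Set (Sym2 V) := (fun x => s(x, par x)) '' {x | x ≠ ρ}
    have hinj : Set.InjOn (fun x => s(x, par x)) {x | x ≠ ρ} := by
      intro x hx y hy hxy
      rcases Sym2.eq_iff.1 hxy with h | h
      · exact h.1
      · have h1 := hrank x hx
        have h2 := hrank y hy
        rw [h.2] at h1
        rw [← h.1] at h2
        omega
    have hsub : E ⊆ G.edgeSet := by
      rintro _ ⟨x, hx, rfl⟩
      exact hadj x hx
    have hcard : E.ncard + 1 = Fintype.card V := by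
      rw [hinj.ncard_image]
      have h1 : {x | x ≠ ρ} = (({ρ} : Set V))ᶜ := by ext; simp
      have h2 := Set.ncard_add_ncard_compl ({ρ} : Set V)
      rw [Set.ncard_singleton, Nat.card_eq_fintype_card] at h2
      rw [h1]; omega
    have hcard' := hG.card_edgeFinset
    have hE : E = G.edgeSet := by
      refine Set.eq_of_subset_of_ncard_le hsub ?_ (Set.toFinite _)
      rw [← SimpleGraph.coe_edgeFinset, Set.ncard_coe_finset]
      omega
    have h1 : s(a, b) ∈ E := by rw [hE]; exact hab
    obtain ⟨x, hx, h2⟩ := h1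
    rcases Sym2.eq_iff.1 h2 with ⟨rfl, rfl⟩ | ⟨rfl, rfl⟩
    · exact Or.inl ⟨hx, rfl⟩
    · exact Or.inr ⟨hx, rfl⟩
  · rintro (⟨h, rfl⟩ | ⟨h, rfl⟩)
    · exact hadj a h
    · exact (hadj b h).symm

theorem exists_isLeveled [Finite V] (L : Lobster V r) :
    ∃ (par : V → V) (v : ℕ → V) (idx lvl : V → ℕ), IsLeveled par r v idx lvl ∧
      (∀ i : Fin r, v i = L.vertex i) ∧
      ∀ a b, L.graph.Adj a b ↔ (a ≠ v 0 ∧ par a = b) ∨ (b ≠ v 0 ∧ par b = a) := by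
  classical
  have hr := L.pos
  let v : ℕ → V := fun i => if h : i < r then L.vertex ⟨i, h⟩ else L.vertex ⟨0, hr⟩
  have hv : ∀ i : Fin r, v i = L.vertex i := fun i => by simp [v]
  have hs : ∀ u, ∃ i : Fin r, (∃ i, L.graph.Adj (L.vertex i) u) → L.graph.Adj (L.vertex i) u :=
    fun u => by
      by_cases h : ∃ i, L.graph.Adj (L.vertex i) u
      · obtain ⟨i, hi⟩ := h
        exact ⟨i, fun _ => hi⟩
      · exact ⟨⟨0, hr⟩, fun h' => absurd h' h⟩
  choose s hs using hs
  have ht : ∀ x, ∃ u, x ∉ Set.range L.vertex → (¬ ∃ i, L.graph.Adj (L.vertex i) x) →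
      L.graph.Adj u x ∧ ∃ i, L.graph.Adj (L.vertex i) u := fun x => by
    by_cases h : x ∉ Set.range L.vertex ∧ ¬ ∃ i, L.graph.Adj (L.vertex i) x
    · obtain ⟨u, hu⟩ := L.exists_center h.1 h.2
      exact ⟨u, fun _ _ => hu⟩
    · exact ⟨x, fun h1 h2 => absurd ⟨h1, h2⟩ h⟩
  choose t ht using ht
  have hn : ∀ x, ∃ i : Fin r, x ∈ Set.range L.vertex → L.vertex i = x := fun x => by
    by_cases h : x ∈ Set.range L.vertex
    · obtain ⟨i, hi⟩ := h
      exact ⟨i, fun _ => hi⟩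
    · exact ⟨⟨0, hr⟩, fun h' => absurd h' h⟩
  choose n hn using hn
  -- Truncated subtraction makes the root `v 0` its own parent, a default value that the
  -- presentation never uses.
  let par : V → V := fun x => if x ∈ Set.range L.vertex then v (n x - 1) else
    if ∃ i, L.graph.Adj (L.vertex i) x then v (s x) else t x
  let lvl : V → ℕ := fun x => if x ∈ Set.range L.vertex then 0 else
    if ∃ i, L.graph.Adj (L.vertex i) x then 1 else 2
  let idx : V → ℕ := fun x => if x ∈ Set.range L.vertex then n x else
    if ∃ i, L.graph.Adj (L.vertex i) x then s x else s (t x)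
  have hvr : ∀ i, v i ∈ Set.range L.vertex := fun i => by
    by_cases h : i < r
    · exact ⟨⟨i, h⟩, (hv ⟨i, h⟩).symm⟩
    · exact ⟨⟨0, hr⟩, by simp [v, h]⟩
  have hnv : ∀ i, i < r → (n (v i) : ℕ) = i := fun i hi => by
    have h1 := hn (v i) (hvr i)
    rw [hv ⟨i, hi⟩] at h1
    have := L.injective h1
    rw [hv ⟨i, hi⟩, this]
  have lvlv : ∀ i, lvl (v i) = 0 := fun i => by simp only [lvl, hvr i, if_true]
  have idxv : ∀ i, i < r → idx (v i) = i := fun i hi => by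
    simp only [idx, hvr i, if_true]; exact hnv i hi
  have cases : ∀ x, (x ∈ Set.range L.vertex ∧ par x = v (n x - 1) ∧ lvl x = 0 ∧ idx x = n x ∧
        x = v (n x)) ∨
      (x ∉ Set.range L.vertex ∧ (∃ i, L.graph.Adj (L.vertex i) x) ∧ par x = v (s x) ∧
        lvl x = 1 ∧ idx x = s x ∧ L.graph.Adj x (par x)) ∨
      (x ∉ Set.range L.vertex ∧ (¬ ∃ i, L.graph.Adj (L.vertex i) x) ∧ par x = t x ∧
        lvl x = 2 ∧ lvl (par x) = 1 ∧ idx x = idx (par x) ∧ L.graph.Adj x (par x)) := by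
    intro x
    by_cases h1 : x ∈ Set.range L.vertex
    · exact Or.inl ⟨h1, by simp only [par, h1, if_true], by simp only [lvl, h1, if_true],
        by simp only [idx, h1, if_true], by rw [hv, hn x h1]⟩
    · refine Or.inr ?_
      by_cases h2 : ∃ i, L.graph.Adj (L.vertex i) x
      · have h3 : par x = v (s x) := by simp only [par, h1, h2, if_true, if_false]
        refine Or.inl ⟨h1, h2, h3, by simp only [lvl, h1, h2, if_true, if_false],
          by simp only [idx, h1, h2, if_true, if_false], ?_⟩
        rw [h3, hv]
        exact (hs x h2).symm
      · have h3 : par x = t x := by simp only [par, h1, h2, if_false]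
        obtain ⟨h4, h5⟩ := ht x h1 h2
        have h6 : t x ∉ Set.range L.vertex := by
          rintro ⟨i, hi⟩
          exact h2 ⟨i, by rw [hi]; exact h4⟩
        refine Or.inr ⟨h1, h2, h3, by simp only [lvl, h1, h2, if_false], ?_, ?_, ?_⟩
        · rw [h3]; simp only [lvl, h6, h5, if_false, if_true]
        · rw [h3]; simp only [idx, h1, h2, h6, h5, if_false, if_true]
        · rw [h3]; exact h4.symm
  refine ⟨par, v, idx, lvl, ⟨?_, ?_, idxv, fun i _ => lvlv i, ?_, ?_, ?_, ?_⟩, hv, ?_⟩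
  · intro x
    simp only [idx]
    split_ifs
    · exact (n x).2
    · exact (s x).2
    · exact (s (t x)).2
  · intro x
    rcases cases x with h | h | h <;> omega
  · intro x hx
    rcases cases x with h | h | h
    · rw [h.2.2.2.1]; exact h.2.2.2.2
    · omega
    · omega
  · intro x hx
    rcases cases x with h | h | h
    · omega
    · rw [h.2.2.1, lvlv, h.2.2.2.1]
    · omega
  · intro x hx
    rcases cases x with h | h | h
    · omega
    · rw [h.2.2.1, idxv _ (s x).2, h.2.2.2.2.1]
    · exact h.2.2.2.2.2.1.symm
  · intro i hi
    rcases cases (v (i + 1)) with h | h | h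
    · rw [h.2.1, hnv _ hi]; rfl
    · exact absurd (hvr _) h.1
    · exact absurd (hvr _) h.1
  · have hn0 : ∀ x, x = v (n x) → x ≠ v 0 → (n x : ℕ) ≠ 0 := fun x h1 h2 h3 => by
      rw [h3] at h1; exact h2 h1
    -- Ranks increase along the spine, and adding `r` puts every vertex off the spine above all
    -- spinal ones.
    refine L.isTree.adj_iff_of_parent (rank := fun x => if lvl x = 0 then idx x else r + lvl x)
      ?_ ?_
    · intro x hx
      rcases cases x with h | h | h
      · have h1 := hn0 x h.2.2.2.2 hx
        have h2 := L.adj_succ (n x - 1) (by have := (n x).2; omega)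
        rw [h.2.1]
        have h3 := (n x).2
        have e1 : v (n x - 1) = L.vertex ⟨n x - 1, by omega⟩ :=
          hv ⟨n x - 1, by omega⟩
        have e2 : x = L.vertex ⟨n x - 1 + 1, by omega⟩ := by
          conv_lhs => rw [h.2.2.2.2, hv]
          congr 1
          ext
          simp only
          omega
        rw [e1]
        conv_lhs => rw [e2]
        exact h2.symm
      · exact h.2.2.2.2.2
      · exact h.2.2.2.2.2.2
    · intro x hx
      rcases cases x with h | h | h
      · have h1 := hn0 x h.2.2.2.2 hx
        have h3 := (n x).2
        rw [h.2.1, lvlv, h.2.2.1, h.2.2.2.1, idxv _ (by omega)]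
        simp only [if_true]
        omega
      · rw [h.2.2.1, lvlv, h.2.2.2.1, idxv _ (s x).2]
        have := (s x).2
        simp only [if_true, one_ne_zero, if_false]
        omega
      · rw [h.2.2.2.1, h.2.2.2.2.1]
        simp

end Lobster

/-! ### Reduced lobes and their isomorphisms -/

namespace Lobster

variable {V : Type*} {r : ℕ}

open IsLeveled

/-- The rooted presentation `par`, `v`, `idx`, `lvl` describes the lobster `L`. -/
structure Presents (L : Lobster V r) (par : V → V) (v : ℕ → V) (idx lvl : V → ℕ) : Prop
    extends IsLeveled par r v idx lvl where
  v_eq : ∀ i : Fin r, v i = L.vertex i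
  adj_iff : ∀ a b, L.graph.Adj a b ↔ (a ≠ v 0 ∧ par a = b) ∨ (b ≠ v 0 ∧ par b = a)

namespace Presents

variable {L : Lobster V r} {par : V → V} {v : ℕ → V} {idx lvl : V → ℕ}

theorem lvl_vertex (hL : L.Presents par v idx lvl) (i : Fin r) : lvl (L.vertex i) = 0 := by
  rw [← hL.v_eq]; exact hL.lvl_v i i.2

theorem idx_vertex (hL : L.Presents par v idx lvl) (i : Fin r) : idx (L.vertex i) = i := by
  rw [← hL.v_eq]; exact hL.idx_v i i.2

theorem eq_vertex (hL : L.Presents par v idx lvl) {i : Fin r} {x : V} (h1 : idx x = i)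
    (h2 : lvl x = 0) : x = L.vertex i := by
  rw [hL.eq_v x h2, h1, hL.v_eq]

theorem mem_range (hL : L.Presents par v idx lvl) {x : V} :
    x ∈ Set.range L.vertex ↔ lvl x = 0 := by
  constructor
  · rintro ⟨i, rfl⟩
    exact hL.lvl_vertex i
  · intro h
    exact ⟨⟨idx x, hL.idx_lt x⟩, (hL.eq_vertex rfl h).symm⟩

/-- Parents of spinal vertices are spinal, so a child of a vertex off the spine is again off the
spine, one level further out. -/
theorem adj_iff_of_lvl_ne_zero (hL : L.Presents par v idx lvl) {a b : V} (ha : lvl a ≠ 0) :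
    L.graph.Adj a b ↔ b = par a ∨ (lvl b = lvl a + 1 ∧ par b = a) := by
  have hr := L.pos
  have h0 : ∀ x, lvl x ≠ 0 → x ≠ v 0 := fun x hx h => hx (h ▸ hL.lvl_v 0 hr)
  rw [hL.adj_iff]
  constructor
  · rintro (h | h)
    · exact Or.inl h.2.symm
    · refine Or.inr ⟨?_, h.2⟩
      by_cases hb : lvl b = 0
      · exfalso
        have h1 := hL.eq_v b hb
        have h2 := hL.idx_lt b
        obtain ⟨j, hj⟩ : ∃ j, idx b = j + 1 := by
          refine Nat.exists_eq_succ_of_ne_zero fun h3 => h.1 ?_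
          rw [h1, h3]
        rw [hj] at h1 h2
        rw [h1, hL.par_v j h2] at h
        exact ha (h.2 ▸ hL.lvl_v j (by omega))
      · rw [← h.2]; exact (hL.lvl_par b hb).symm
  · rintro (h | h)
    · exact Or.inl ⟨h0 a ha, h.symm⟩
    · exact Or.inr ⟨h0 b (by omega), h.2⟩

theorem adj_vertex_iff (hL : L.Presents par v idx lvl) {i : Fin r} {u : V} (hu : lvl u ≠ 0) :
    L.graph.Adj (L.vertex i) u ↔ idx u = i ∧ lvl u = 1 := by
  have h0 := hL.lvl_vertex i
  have h1 := hL.lvl_par u hu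
  have h2 := hL.idx_par u hu
  rw [SimpleGraph.adj_comm, hL.adj_iff_of_lvl_ne_zero hu]
  constructor
  · rintro (h | h)
    · rw [← h] at h1 h2
      rw [hL.idx_vertex] at h2
      omega
    · omega
  · intro h
    exact Or.inl (hL.eq_vertex (by omega) (by omega)).symm

theorem mem_branchCenters (hL : L.Presents par v idx lvl) {i : Fin r} {u : V} :
    u ∈ L.branchCenters i ↔ idx u = i ∧ lvl u = 1 := by
  rw [branchCenters, Set.mem_ofPred_eq, hL.mem_range]
  constructor
  · rintro ⟨h1, h2⟩
    exact (hL.adj_vertex_iff h2).1 h1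
  · intro h
    have h2 : lvl u ≠ 0 := by omega
    exact ⟨(hL.adj_vertex_iff h2).2 h, h2⟩

theorem mem_lobeVerts (hL : L.Presents par v idx lvl) {i : Fin r} {x : V} :
    x ∈ L.lobeVerts i ↔ idx x = i := by
  simp only [lobeVerts, Set.mem_union, Set.mem_singleton_iff, hL.mem_branchCenters,
    Set.mem_ofPred_eq, hL.mem_range]
  constructor
  · rintro ((rfl | h) | ⟨h1, u, h2, h3⟩)
    · exact hL.idx_vertex i
    · exact h.1
    · have h4 := hL.lvl_par u (by omega)
      rcases (hL.adj_iff_of_lvl_ne_zero (by omega)).1 h3 with h | h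
      · rw [← h] at h4; omega
      · rw [← hL.idx_par x h1, h.2, h2.1]
  · intro h
    have h1 := hL.lvl_le x
    have h2 : lvl x = 0 ∨ lvl x = 1 ∨ lvl x = 2 := by omega
    rcases h2 with h2 | h2 | h2
    · exact Or.inl (Or.inl (hL.eq_vertex h h2))
    · exact Or.inl (Or.inr ⟨h, h2⟩)
    · have h3 := hL.lvl_par x (by omega)
      have h4 := hL.idx_par x (by omega)
      exact Or.inr ⟨by omega, par x, by omega,
        (hL.adj_iff_of_lvl_ne_zero (by omega)).2 (Or.inr ⟨by omega, rfl⟩)⟩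

theorem reducedLobe_adj {i : Fin r} {a b : V} :
    (L.reducedLobe i).Adj a b ↔
      a ∈ (L.reducedLobe i).verts ∧ b ∈ (L.reducedLobe i).verts ∧ L.graph.Adj a b := by
  rw [reducedLobe, SimpleGraph.Subgraph.deleteVerts_adj, lobe, SimpleGraph.Subgraph.induce_adj,
    SimpleGraph.Subgraph.deleteVerts_verts, SimpleGraph.Subgraph.induce_verts, Set.mem_sdiff,
    Set.mem_sdiff, SimpleGraph.Subgraph.top_adj]
  tauto

theorem coe_adj {i : Fin r} {a b : (L.reducedLobe i).verts} :
    (L.reducedLobe i).coe.Adj a b ↔ L.graph.Adj a b := by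
  rw [SimpleGraph.Subgraph.coe_adj, reducedLobe_adj]
  simp

variable [Fintype V] [DecidableEq V]

theorem mem_pendantVerts (hL : L.Presents par v idx lvl) {i : Fin r} {u : V} :
    u ∈ L.pendantVerts i ↔ u ∈ nodes idx lvl i 1 ∧ u ∉ essential par idx lvl i := by
  simp only [pendantVerts, Set.mem_ofPred_eq, hL.mem_branchCenters, mem_nodes, mem_essential]
  refine and_congr_right fun hu => ?_
  have h1 := hL.lvl_par u (by omega)
  constructor
  · rintro h ⟨-, x, hx, hxu⟩
    have h2 := h x ((hL.adj_iff_of_lvl_ne_zero (by omega)).2 (Or.inr ⟨by omega, hxu⟩))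
    rw [h2, hL.lvl_vertex] at hx
    omega
  · intro h w hw
    rcases (hL.adj_iff_of_lvl_ne_zero (by omega)).1 hw with h2 | h2
    · rw [h2]
      exact hL.eq_vertex (by rw [hL.idx_par u (by omega), hu.1]) (by omega)
    · exact absurd ⟨hu, w, by omega, h2.2⟩ h

theorem mem_verts (hL : L.Presents par v idx lvl) {i : Fin r} {x : V} :
    x ∈ (L.reducedLobe i).verts ↔ idx x = i ∧ (lvl x = 1 → x ∈ essential par idx lvl i) := by
  rw [reducedLobe, SimpleGraph.Subgraph.deleteVerts_verts, Set.mem_sdiff, hL.mem_pendantVerts,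
    lobe, SimpleGraph.Subgraph.induce_verts, hL.mem_lobeVerts, mem_nodes]
  refine and_congr_right fun h => ?_
  tauto

theorem vertex_mem_verts (hL : L.Presents par v idx lvl) (i : Fin r) :
    L.vertex i ∈ (L.reducedLobe i).verts :=
  hL.mem_verts.2 ⟨hL.idx_vertex i, fun h => by rw [hL.lvl_vertex] at h; omega⟩

theorem essential_mem_verts (hL : L.Presents par v idx lvl) {i : Fin r} {w : V}
    (hw : w ∈ essential par idx lvl i) : w ∈ (L.reducedLobe i).verts :=
  hL.mem_verts.2 ⟨(mem_essential.1 hw).1.1, fun _ => hw⟩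

theorem kid_mem_verts (hL : L.Presents par v idx lvl) {i : Fin r} {w x : V}
    (hw : w ∈ essential par idx lvl i) (hx : x ∈ kids par lvl w) :
    x ∈ (L.reducedLobe i).verts := by
  rw [mem_kids] at hx
  refine hL.mem_verts.2 ⟨?_, fun h => by omega⟩
  rw [← hL.idx_par x (by omega), hx.2]
  exact (mem_essential.1 hw).1.1

theorem adj_vertex_of_essential (hL : L.Presents par v idx lvl) {i : Fin r} {w : V}
    (hw : w ∈ essential par idx lvl i) : L.graph.Adj (L.vertex i) w := by
  have h := (mem_essential.1 hw).1
  exact (hL.adj_vertex_iff (by omega)).2 h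

theorem adj_kid (hL : L.Presents par v idx lvl) {i : Fin r} {w x : V}
    (hw : w ∈ essential par idx lvl i) (hx : x ∈ kids par lvl w) : L.graph.Adj w x := by
  have h := (mem_essential.1 hw).1
  rw [mem_kids] at hx
  exact (hL.adj_iff_of_lvl_ne_zero (by omega)).2 (Or.inr ⟨by omega, hx.2⟩)

theorem essential_of_adj (hL : L.Presents par v idx lvl) {i : Fin r} {w : V}
    (hw : w ∈ (L.reducedLobe i).verts) (h : L.graph.Adj (L.vertex i) w) :
    w ∈ essential par idx lvl i := by
  rw [hL.mem_verts] at hw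
  have h0 : lvl w ≠ 0 := fun h0 => by
    rw [hL.eq_vertex hw.1 h0] at h
    exact h.ne rfl
  exact hw.2 ((hL.adj_vertex_iff h0).1 h).2

theorem neighborSet_eq (hL : L.Presents par v idx lvl) (i : Fin r) :
    (L.reducedLobe i).neighborSet (L.vertex i) = essential par idx lvl i := by
  ext w
  rw [SimpleGraph.Subgraph.mem_neighborSet, reducedLobe_adj, Finset.mem_coe]
  exact ⟨fun h => hL.essential_of_adj h.2.1 h.2.2, fun h =>
    ⟨hL.vertex_mem_verts i, hL.essential_mem_verts h, hL.adj_vertex_of_essential h⟩⟩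

/-- With two essential branches, the spinal vertex starts paths of length two through two different
neighbours. A vertex off the spine cannot: its children, if any, are leaves, so every such path
leaves it through its parent. -/
theorem iso_vertex (hL : L.Presents par v idx lvl) {i j : Fin r}
    (φ : (L.reducedLobe i).coe ≃g (L.reducedLobe j).coe)
    (hi : 1 < (essential par idx lvl i).card) :
    φ ⟨L.vertex i, hL.vertex_mem_verts i⟩ = ⟨L.vertex j, hL.vertex_mem_verts j⟩ := by
  obtain ⟨w, hw, w', hw', hne⟩ := Finset.one_lt_card.1 hi
  obtain ⟨-, x, hx⟩ := mem_essential.1 hw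
  obtain ⟨-, x', hx'⟩ := mem_essential.1 hw'
  rw [← mem_kids] at hx hx'
  set a := φ ⟨L.vertex i, hL.vertex_mem_verts i⟩ with ha
  have aux : ∀ w (hw : w ∈ essential par idx lvl i) x (hx : x ∈ kids par lvl w),
      L.graph.Adj a (φ ⟨w, hL.essential_mem_verts hw⟩) ∧
      L.graph.Adj (φ ⟨w, hL.essential_mem_verts hw⟩) (φ ⟨x, hL.kid_mem_verts hw hx⟩) ∧
      (φ ⟨x, hL.kid_mem_verts hw hx⟩ : V) ≠ a := by
    intro w hw x hx
    refine ⟨coe_adj.1 (φ.map_adj_iff.2 (coe_adj.2 (hL.adj_vertex_of_essential hw))),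
      coe_adj.1 (φ.map_adj_iff.2 (coe_adj.2 (hL.adj_kid hw hx))), fun h => ?_⟩
    have h1 := φ.injective (Subtype.ext h)
    have h2 : x = L.vertex i := congrArg Subtype.val h1
    have h3 := (mem_kids.1 hx).1
    rw [h2, hL.lvl_vertex] at h3
    omega
  obtain ⟨b1, b2, b3⟩ := aux w hw x hx
  obtain ⟨c1, c2, c3⟩ := aux w' hw' x' hx'
  have hbc : (φ ⟨w, hL.essential_mem_verts hw⟩ : V) ≠ φ ⟨w', hL.essential_mem_verts hw'⟩ := by
    intro h
    exact hne (congrArg Subtype.val (φ.injective (Subtype.ext h)))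
  by_cases h0 : lvl a = 0
  · exact Subtype.ext (hL.eq_vertex (hL.mem_verts.1 a.2).1 h0)
  · exfalso
    have aux2 : ∀ b c : V, L.graph.Adj a b → L.graph.Adj b c → c ≠ a → b = par a := by
      intro b c h1 h2 h3
      rcases (hL.adj_iff_of_lvl_ne_zero h0).1 h1 with h4 | h4
      · exact h4
      · exfalso
        rcases (hL.adj_iff_of_lvl_ne_zero (by omega)).1 h2 with h5 | h5
        · exact h3 (h5.trans h4.2)
        · have := hL.lvl_le c
          omega
    exact hbc ((aux2 _ _ b1 b2 b3).trans (aux2 _ _ c1 c2 c3).symm)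

theorem iso_essential (hL : L.Presents par v idx lvl) {i j : Fin r}
    (φ : (L.reducedLobe i).coe ≃g (L.reducedLobe j).coe)
    (hφ : φ ⟨L.vertex i, hL.vertex_mem_verts i⟩ = ⟨L.vertex j, hL.vertex_mem_verts j⟩)
    {w : V} (hw : w ∈ essential par idx lvl i) :
    (φ ⟨w, hL.essential_mem_verts hw⟩ : V) ∈ essential par idx lvl j := by
  refine hL.essential_of_adj (φ ⟨w, hL.essential_mem_verts hw⟩).2 ?_
  have h := φ.map_adj_iff.2 (coe_adj.2 (hL.adj_vertex_of_essential hw) :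
    (L.reducedLobe i).coe.Adj ⟨L.vertex i, hL.vertex_mem_verts i⟩
      ⟨w, hL.essential_mem_verts hw⟩)
  rw [hφ] at h
  exact coe_adj.1 h

/-- Neighbours of a center other than the spinal vertex are its children, and the only vertex mapped
to `L.vertex j` is `L.vertex i`. The reverse inequality comes from the inverse isomorphism. -/
theorem card_kids_le (hL : L.Presents par v idx lvl) {i j : Fin r}
    (φ : (L.reducedLobe i).coe ≃g (L.reducedLobe j).coe)
    (hφ : φ ⟨L.vertex i, hL.vertex_mem_verts i⟩ = ⟨L.vertex j, hL.vertex_mem_verts j⟩)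
    {w : V} (hw : w ∈ essential par idx lvl i) :
    (kids par lvl w).card ≤ (kids par lvl (φ ⟨w, hL.essential_mem_verts hw⟩)).card := by
  classical
  refine Finset.card_le_card_of_injOn
    (fun x => if hx : x ∈ (L.reducedLobe i).verts then φ ⟨x, hx⟩ else x) ?_ ?_
  · intro x hx
    have h1 := hL.kid_mem_verts hw hx
    have h2 := (mem_essential.1 (hL.iso_essential φ hφ hw)).1
    have h3 : L.graph.Adj (φ ⟨w, hL.essential_mem_verts hw⟩) (φ ⟨x, h1⟩) :=
      coe_adj.1 (φ.map_adj_iff.2 (coe_adj.2 (hL.adj_kid hw hx)))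
    simp only [h1, dif_pos]
    rw [Finset.mem_coe, mem_kids]
    rcases (hL.adj_iff_of_lvl_ne_zero (by omega)).1 h3 with h4 | h4
    · exfalso
      have h5 := hL.lvl_par (φ ⟨w, hL.essential_mem_verts hw⟩) (by omega)
      rw [← h4] at h5
      have h6 : φ ⟨x, h1⟩ = φ ⟨L.vertex i, hL.vertex_mem_verts i⟩ := by
        rw [hφ]
        exact Subtype.ext (hL.eq_vertex (hL.mem_verts.1 (φ ⟨x, h1⟩).2).1 (by omega))
      have h7 : x = L.vertex i := congrArg Subtype.val (φ.injective h6)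
      have h8 := (mem_kids.1 (Finset.mem_coe.1 hx)).1
      rw [h7, hL.lvl_vertex] at h8
      omega
    · exact ⟨by omega, h4.2⟩
  · intro x hx y hy hxy
    have h1 := hL.kid_mem_verts hw hx
    have h2 := hL.kid_mem_verts hw hy
    simp only [h1, h2, dif_pos] at hxy
    exact congrArg Subtype.val (φ.injective (Subtype.ext hxy))

theorem exists_bijOn_of_iso_vertex (hL : L.Presents par v idx lvl) {i j : Fin r}
    (φ : (L.reducedLobe i).coe ≃g (L.reducedLobe j).coe)
    (hφ : φ ⟨L.vertex i, hL.vertex_mem_verts i⟩ = ⟨L.vertex j, hL.vertex_mem_verts j⟩) :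
    ∃ ψ : V → V, Set.BijOn ψ (essential par idx lvl i) (essential par idx lvl j) ∧
      ∀ w ∈ essential par idx lvl i, (kids par lvl (ψ w)).card = (kids par lvl w).card := by
  classical
  have hφ' : φ.symm ⟨L.vertex j, hL.vertex_mem_verts j⟩ =
      ⟨L.vertex i, hL.vertex_mem_verts i⟩ := by
    rw [← hφ]; exact φ.symm_apply_apply _
  let ψ : V → V := fun x => if hx : x ∈ (L.reducedLobe i).verts then φ ⟨x, hx⟩ else x
  have hψ : ∀ w (hw : w ∈ essential par idx lvl i), ψ w = φ ⟨w, hL.essential_mem_verts hw⟩ :=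
    fun w hw => by simp only [ψ, hL.essential_mem_verts hw, dif_pos]
  refine ⟨ψ, ⟨?_, ?_, ?_⟩, ?_⟩
  · intro w hw
    rw [hψ w hw]
    exact hL.iso_essential φ hφ hw
  · intro w hw w' hw' h
    rw [hψ w hw, hψ w' hw'] at h
    exact congrArg Subtype.val (φ.injective (Subtype.ext h))
  · intro u hu
    have h1 := hL.iso_essential φ.symm hφ' hu
    refine ⟨_, h1, ?_⟩
    rw [hψ _ h1]
    exact congrArg Subtype.val (φ.apply_symm_apply ⟨u, hL.essential_mem_verts hu⟩)
  · intro w hw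
    rw [hψ w hw]
    refine le_antisymm ?_ (hL.card_kids_le φ hφ hw)
    have h1 := hL.card_kids_le φ.symm hφ' (hL.iso_essential φ hφ hw)
    have h2 : φ.symm (φ ⟨w, hL.essential_mem_verts hw⟩) = ⟨w, hL.essential_mem_verts hw⟩ :=
      φ.symm_apply_apply _
    simpa [h2] using h1

theorem subsingleton_verts (hL : L.Presents par v idx lvl) {i : Fin r} :
    (L.reducedLobe i).verts.Subsingleton ↔ essential par idx lvl i = ∅ := by
  constructor
  · intro h
    rw [Finset.eq_empty_iff_forall_notMem]
    intro w hw
    exact (hL.adj_vertex_of_essential hw).ne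
      (h (hL.vertex_mem_verts i) (hL.essential_mem_verts hw))
  · intro h
    have key : ∀ x ∈ (L.reducedLobe i).verts, x = L.vertex i := by
      intro x hx
      rw [hL.mem_verts, h] at hx
      refine hL.eq_vertex hx.1 ?_
      by_contra h0
      have h1 := hL.lvl_le x
      have h2 : lvl x ≠ 1 := fun h2 => by simpa using hx.2 h2
      have h3 := hL.lvl_par x h0
      have h4 : par x ∈ essential par idx lvl i :=
        mem_essential.2 ⟨⟨(hL.idx_par x h0).trans hx.1, by omega⟩, x, by omega, rfl⟩
      rw [h] at h4
      simp at h4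
    intro x hx y hy
    rw [key x hx, key y hy]

theorem ncard_verts_of_singleton (hL : L.Presents par v idx lvl) {i : Fin r} {w : V}
    (h : essential par idx lvl i = {w}) :
    (L.reducedLobe i).verts.ncard = (kids par lvl w).card + 2 := by
  have hw : w ∈ essential par idx lvl i := by simp [h]
  have hw1 := (mem_essential.1 hw).1
  have h1 : (L.reducedLobe i).verts = ↑(insert (L.vertex i) (insert w (kids par lvl w))) := by
    ext x
    rw [Finset.mem_coe, Finset.mem_insert, Finset.mem_insert]
    constructor
    · intro hx
      rw [hL.mem_verts, h, Finset.mem_singleton] at hx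
      have h2 := hL.lvl_le x
      have h3 : lvl x = 0 ∨ lvl x = 1 ∨ lvl x = 2 := by omega
      rcases h3 with h3 | h3 | h3
      · exact Or.inl (hL.eq_vertex hx.1 h3)
      · exact Or.inr (Or.inl (hx.2 h3))
      · have h4 := hL.lvl_par x (by omega)
        have h5 : par x ∈ essential par idx lvl i :=
          mem_essential.2 ⟨⟨(hL.idx_par x (by omega)).trans hx.1, by omega⟩, x, h3, rfl⟩
        rw [h, Finset.mem_singleton] at h5
        exact Or.inr (Or.inr (mem_kids.2 ⟨h3, h5⟩))
    · rintro (rfl | rfl | hx)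
      · exact hL.vertex_mem_verts i
      · exact hL.essential_mem_verts hw
      · exact hL.kid_mem_verts hw hx
  rw [h1, Set.ncard_coe_finset, Finset.card_insert_of_notMem, Finset.card_insert_of_notMem]
  · rw [mem_kids]; omega
  · rw [Finset.mem_insert, mem_kids, hL.lvl_vertex]
    rintro (h2 | h2)
    · rw [← h2, hL.lvl_vertex] at hw1; omega
    · omega

/-- If either lobe has two essential branches, the isomorphism respects the spinal vertices.
Otherwise each reduced lobe is a single vertex or a star around its only center, where the
isomorphism may move the spinal vertex to another leaf; counting vertices then suffices. -/
theorem exists_bijOn_of_iso (hL : L.Presents par v idx lvl) {i j : Fin r}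
    (φ : (L.reducedLobe i).coe ≃g (L.reducedLobe j).coe) :
    ∃ ψ : V → V, Set.BijOn ψ (essential par idx lvl i) (essential par idx lvl j) ∧
      ∀ w ∈ essential par idx lvl i, (kids par lvl (ψ w)).card = (kids par lvl w).card := by
  by_cases hi : 1 < (essential par idx lvl i).card
  · exact hL.exists_bijOn_of_iso_vertex φ (hL.iso_vertex φ hi)
  by_cases hj : 1 < (essential par idx lvl j).card
  · refine hL.exists_bijOn_of_iso_vertex φ ?_
    rw [← hL.iso_vertex φ.symm hj]
    exact φ.apply_symm_apply _
  have hsub : essential par idx lvl i = ∅ ↔ essential par idx lvl j = ∅ := by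
    rw [← hL.subsingleton_verts, ← hL.subsingleton_verts, ← Set.subsingleton_coe,
      ← Set.subsingleton_coe]
    exact φ.toEquiv.subsingleton_congr
  by_cases h0 : essential par idx lvl i = ∅
  · rw [h0, hsub.1 h0]
    exact ⟨id, by simp, by simp⟩
  · have h0' : essential par idx lvl j ≠ ∅ := fun h => h0 (hsub.2 h)
    rw [← Ne, ← Finset.nonempty_iff_ne_empty, ← Finset.card_pos] at h0
    rw [← Finset.nonempty_iff_ne_empty, ← Finset.card_pos] at h0'
    obtain ⟨w, hw⟩ := Finset.card_eq_one.1 (show (essential par idx lvl i).card = 1 by omega)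
    obtain ⟨u, hu⟩ := Finset.card_eq_one.1 (show (essential par idx lvl j).card = 1 by omega)
    have h1 : (L.reducedLobe i).verts.ncard = (L.reducedLobe j).verts.ncard :=
      Nat.card_congr φ.toEquiv
    rw [hL.ncard_verts_of_singleton hw, hL.ncard_verts_of_singleton hu] at h1
    refine ⟨fun _ => u, ?_, ?_⟩
    · rw [hw, hu, Finset.coe_singleton, Finset.coe_singleton]
      exact Set.bijOn_singleton.2 rfl
    · intro x hx
      rw [hw, Finset.mem_singleton] at hx
      subst hx
      show (kids par lvl u).card = _
      omega

end Presents

end Lobster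

/-! ### The main theorem -/

theorem mainTheorem5 {V : Type*} [Finite V] {r : ℕ} (L : Lobster V r)
    (hsim : L.IsPairwiseSimilar)
    (hpend : ∀ i : Fin r, L.IsEssentiallyEven i → (L.pendantVerts i).Nonempty) :
    IsGraceful L.graph := by
  classical
  have := Fintype.ofFinite V
  obtain ⟨par, v, idx, lvl, hlev, hv, hadj⟩ := L.exists_isLeveled
  have hL : L.Presents par v idx lvl := ⟨hlev, hv, hadj⟩
  obtain ⟨f, hf⟩ := hlev.exists_labeling L.pos
    (by
      intro i hi h1 h2
      obtain ⟨u, hu⟩ := hpend ⟨i, hi⟩ (by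
        rw [Lobster.IsEssentiallyEven, hL.neighborSet_eq, Set.ncard_coe_finset]
        exact ⟨h1, h2⟩)
      rw [hL.mem_pendantVerts] at hu
      exact ⟨u, hu⟩)
    (by
      intro k hk
      obtain ⟨φ⟩ := hsim k hk
      exact hL.exists_bijOn_of_iso φ)
  have hcast : ∀ x, ((f x).toNat : ℤ) = f x := fun x =>
    Int.toNat_of_nonneg (hf.nonneg x (Finset.mem_univ x))
  -- A tree has one edge fewer than vertices, so labels below the number of vertices are at most
  -- `m`.
  have hcard : L.graph.edgeSet.ncard + 1 = Fintype.card V := by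
    rw [← L.isTree.card_edgeFinset, ← SimpleGraph.coe_edgeFinset, Set.ncard_coe_finset]
  have hedge : ∀ a b, L.graph.Adj a b → ∃ x, x ≠ v 0 ∧ s(a, b) = s(x, par x) ∧
      |f a - f b| = |f x - f (par x)| := by
    intro a b hab
    rcases (hadj a b).1 hab with ⟨h, rfl⟩ | ⟨h, rfl⟩
    · exact ⟨a, h, rfl, rfl⟩
    · exact ⟨b, h, Sym2.eq_swap, abs_sub_comm _ _⟩
  refine ⟨fun x => (f x).toNat, ?_, ?_, ?_⟩
  · intro x y hxy
    refine hf.inj x (Finset.mem_univ x) y (Finset.mem_univ y) ?_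
    rw [← hcast x, ← hcast y]
    exact congrArg Nat.cast hxy
  · intro x
    have h1 := hf.lt x (Finset.mem_univ x)
    rw [Finset.card_univ, ← hcast x] at h1
    simp only
    omega
  · intro a b c d hab hcd h
    simp only [hcast] at h
    obtain ⟨x, hx, e1, e2⟩ := hedge a b hab
    obtain ⟨y, hy, e3, e4⟩ := hedge c d hcd
    rw [e2, e4] at h
    rw [e1, e3, hf.diff x (Finset.mem_univ x) hx y (Finset.mem_univ y) hy h]
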